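/- Consider, for each integer $s\ge1$, a $GI/G/s$ loss system: customers arrive one by one, a customer who finds all $s$ servers busy is lost, and every other customer starts service at once. The interarrival times are $U_k=U_k^0/s$, where $U^0_1,U^0_2,\dots\ge 0$ are i.i.d. with mean $1/\lambda\in(0,\infty)$ and finite exponential moments near $0$; the service times $V_1,V_2,\dots\ge0$ are i.i.d. with a law not depending on $s$, independent of the arrivals, with distribution function $F$, density $f$, $\bar F=1-F$. Assume $\lim_{y\to\infty}y f(y)/\bar F(y)=\infty$ (with $f/\bar F:=\infty$ where $\bar F=0$) and $\lambda EV<1$. Let $\kappa^0(\theta)=\log Ee^{\theta U^0}$ (on the set where it is finite) and $\psi_N(\theta)=-(\kappa^0)^{-1}(-\theta)$; assume that $\psi_N$ is defined on all of $\mathbb R$, is $C^2$ and strictly convex, that $\psi_N'(\theta)\to\infty$ and $\theta\frac{d}{d\theta}\log\psi_N(\theta)\to\infty$ as $\theta\to\infty$. Put $$\psi_\infty(\theta)=\int_0^\infty\psi_N\bigl(\log(e^\theta\bar F(u)+F(u))\bigr)\,du,\qquad I^*=\theta_\infty-\psi_\infty(\theta_\infty),$$ where $\theta_\infty$ is the positive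 root of $\psi_\infty'(\theta)=1$, which exists and is unique. Fix constants $\Delta,C^*,\eta,\gamma>0$ and let $$\nu(y)=\Bigl(\lambda\int_y^\infty\bar F(u)du\Bigr)^{1/(2+\eta)},\qquad \xi(y)=\nu(y)+\gamma\int_y^\infty\nu(u)du,$$ $$J(y)=J_s(y)=\Bigl(\lambda s\int_y^\infty\bar F(u)du-\sqrt s\,C^*\xi(y),\ \lambda s\int_y^\infty\bar F(u)du+\sqrt s\,C^*\xi(y)\Bigr)\quad\text{if }\bar F(y)>0,$$ and $J(y)=\{0\}$ if $\bar F(y)=0$. Let $Q(t,y)$ be the number of customers in the system at time $t$ with residual service time larger than $y$, and let $\tau_A$ be the first time $t\in\{\Delta,2\Delta,\dots\}$ with $Q(t,y)\in J(y)$ for all $y\ge0$. Let $\tau_s$ be the time of the first loss, equivalently the first time $t>0$ at which the number of customers in the $GI/G/\infty$ system with the same initial state, arrivals and service times exceeds $s$. Let $P_r$ be the law of the system started at time $0$ with $r(y)$ customers of residual service time larger than $y$ $(y\ge0)$, where $r=r_s$ is nonincreasing, right-continuous and integer-valued, and with an arbitrary admissible age $b=b_s\ge0$ (time since the last arrival;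 $P(U^0>sb)>0$), i.e. the first interarrival time, multiplied by $s$, has the law of $U^0-sb$ given $U^0>sb$. Then for all such initial states with $r(y)\in J(y)$ for all $y\ge0$ (for all large $s$), $$\liminf_{s\to\infty}\frac1s\log P_r(\tau_s<\tau_A)\ge-I^*,$$ and the same holds when $Q$ and hence $\tau_A$ are those of the $GI/G/\infty$ system, with $\tau_s$ its first passage time above $s$. -/

import Mathlib

open MeasureTheory ProbabilityTheory Filter Topology Set

namespace LossQueue

noncomputable section

/-! The arrival law: `μU` is the law of the base interarrival time. -/

/-- `ψ_N(θ) = -(κ⁰)⁻¹(-θ)`, where `κ⁰(x) = log E exp(x U⁰)` is considered on the set of those `x`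
at which the exponential moment is finite. -/
def psiN (μU : Measure ℝ) (θ : ℝ) : ℝ :=
  -Function.invFunOn (cgf id μU) (integrableExpSet id μU) (-θ)

/-- Assumptions on the base interarrival law, with arrival rate `lam`. -/
structure ArrivalLaw (lam : ℝ) (μU : Measure ℝ) : Prop where
  rate_pos : 0 < lam
  nonneg : μU (Iio 0) = 0
  mean : ∫ u, u ∂μU = 1 / lam
  exp_moments : 0 ∈ interior (integrableExpSet id μU)
  /-- The domain of `ψ_N` is the whole line. -/
  dom : ∀ θ : ℝ, ∃ x ∈ integrableExpSet id μU, cgf id μU x = -θ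
  smooth : ContDiff ℝ 2 (psiN μU)
  strictConvex : StrictConvexOn ℝ univ (psiN μU)
  steep : Tendsto (deriv (psiN μU)) atTop atTop
  technical : Tendsto (fun θ => θ * deriv (fun x => Real.log (psiN μU x)) θ) atTop atTop

/-! The service law: `μV` is the law of a service time. -/

/-- The tail distribution function of the service times. -/
def Fbar (μV : Measure ℝ) (y : ℝ) : ℝ := 1 - cdf μV y

/-- The hazard rate `f / Fbar`, equal to `∞` where `Fbar` vanishes. -/
def hazard (μV : Measure ℝ) (f : ℝ → ℝ) (y : ℝ) : ENNReal :=
  open Classical in if Fbar μV y = 0 then ⊤ else ENNReal.ofReal (f y / Fbar μV y)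

/-- Assumptions on the service law, with density `f`. -/
structure ServiceLaw (μV : Measure ℝ) (f : ℝ → ℝ) : Prop where
  measurable : Measurable f
  density_nonneg : ∀ y, 0 ≤ f y
  density : μV = volume.withDensity fun y => ENNReal.ofReal (f y)
  nonneg : μV (Iio 0) = 0
  light_tail : Tendsto (fun y : ℝ => ENNReal.ofReal y * hazard μV f y) atTop (𝓝 ⊤)

/-- `∫_y^∞ Fbar(u) du`. -/
def tailInt (μV : Measure ℝ) (y : ℝ) : ℝ := ∫ u in Ioi y, Fbar μV u

/-! The rate. -/

/-- `ψ_∞(θ) = ∫_0^∞ ψ_N(log(e^θ Fbar(u) + F(u))) du`. -/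
def psiInf (μU μV : Measure ℝ) (θ : ℝ) : ℝ :=
  ∫ u in Ioi (0 : ℝ), psiN μU (Real.log (Real.exp θ * Fbar μV u + cdf μV u))

/-- `θ` is a positive root of `ψ_∞'(θ) = 1`. -/
def IsThetaInf (μU μV : Measure ℝ) (θ : ℝ) : Prop :=
  0 < θ ∧ HasDerivAt (psiInf μU μV) 1 θ

/-! The confidence band and the recurrent set. -/

/-- `ν(y) = (λ ∫_y^∞ Fbar(u) du)^(1/(2+η))`. -/
def nu (lam η : ℝ) (μV : Measure ℝ) (y : ℝ) : ℝ := (lam * tailInt μV y) ^ (1 / (2 + η))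

/-- `ξ(y) = ν(y) + γ ∫_y^∞ ν(u) du`. -/
def xi (lam η γ : ℝ) (μV : Measure ℝ) (y : ℝ) : ℝ :=
  nu lam η μV y + γ * ∫ u in Ioi y, nu lam η μV u

/-- The band `J(y)` of the `s`-th system. Beyond the support of the service times (only when they
are bounded) residual service times larger than `y` do not occur, and the band is `{0}`. -/
def band (lam C η γ : ℝ) (μV : Measure ℝ) (s : ℕ) (y : ℝ) : Set ℝ :=
  open Classical in
  if Fbar μV y = 0 then {0}
  else Ioo (lam * s * tailInt μV y - √s * C * xi lam η γ μV y)
    (lam * s * tailInt μV y + √s * C * xi lam η γ μV y)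

/-- `q(·) ∈ J(·)`, where `q y` is the number of customers with residual service time above `y`. -/
def InBand (lam C η γ : ℝ) (μV : Measure ℝ) (s : ℕ) (q : ℝ → ℕ) : Prop :=
  ∀ y : ℝ, 0 ≤ y → (q y : ℝ) ∈ band lam C η γ μV s y

/-- `r` (number of initial customers with residual service time above `y`, as a function of `y`)
and `b` (time since the last arrival) form an initial state of the `s`-th system with
`r(·) ∈ J(·)`. The age must be one that a base interarrival time, divided by `s`, can exceed. -/
structure IsInitialState (lam C η γ : ℝ) (μU μV : Measure ℝ) (s : ℕ) (r : ℝ → ℕ) (b : ℝ) :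
    Prop where
  antitone : AntitoneOn r (Ici 0)
  rightCts : ∀ y : ℝ, 0 ≤ y → ContinuousWithinAt r (Ici y) y
  inBand : InBand lam C η γ μV s r
  age_nonneg : 0 ≤ b
  age_possible : μU (Ioi (s * b)) ≠ 0

/-! The driving randomness: the first interarrival time, the subsequent interarrival times
(all in the base time scale), and the service times. -/

/-- A realization `(U₀, (U₁, U₂, …), (V₁, V₂, …))`, the sequences being indexed from `0`. -/
abbrev Path := ℝ × (ℕ → ℝ) × (ℕ → ℝ)

/-- The law of the realization when the initial age is `b`: the first interarrival time has the law
of `U⁰ - s b` given `U⁰ > s b`, and everything is independent. -/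
def pathLaw (μU μV : Measure ℝ) [IsProbabilityMeasure μU] [IsProbabilityMeasure μV]
    (s : ℕ) (b : ℝ) : Measure Path :=
  ((cond μU (Ioi (s * b))).map fun x => x - s * b).prod
    ((Measure.infinitePi fun _ : ℕ => μU).prod (Measure.infinitePi fun _ : ℕ => μV))

/-- Arrival time in the `s`-th system of the customer with index `i` (the first one has index 0). -/
def arrival (s : ℕ) (ω : Path) (i : ℕ) : ℝ := (ω.1 + ∑ j ∈ Finset.range i, ω.2.1 j) / s

/-- Time at which the service of customer `i` is completed, if it is served. -/
def completion (s : ℕ) (ω : Path) (i : ℕ) : ℝ := arrival s ω i + ω.2.2 i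

/-! The `GI/G/∞` system. -/

/-- `Q^∞(t, y)`: number of customers present at time `t` with residual service time above `y`.
(Almost surely only finitely many customers have arrived by time `t`.) -/
def QInf (s : ℕ) (r : ℝ → ℕ) (ω : Path) (t y : ℝ) : ℕ :=
  r (t + y) + {i : ℕ | arrival s ω i ≤ t ∧ y < completion s ω i - t}.ncard

/-- `τ_s = inf {t > 0 : Q^∞(t) > s}`, equal to `∞` if there is no such `t`. -/
def overflowTime (s : ℕ) (r : ℝ → ℕ) (ω : Path) : EReal :=
  sInf ((fun t : ℝ => (t : EReal)) '' {t : ℝ | 0 < t ∧ s < QInf s r ω t 0})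

/-! The `GI/G/s` loss system. -/

/-- The indices among the first `n` arriving customers of those that are not lost. A customer is
lost iff the `s` servers are all busy on arrival. -/
def admitted (s : ℕ) (r : ℝ → ℕ) (ω : Path) : ℕ → Finset ℕ
  | 0 => ∅
  | n + 1 =>
    open Classical in
    if r (arrival s ω n) +
        ((admitted s r ω n).filter fun j => arrival s ω n < completion s ω j).card < s
    then insert n (admitted s r ω n)
    else admitted s r ω n

/-- Customer `i` is not lost. -/
def IsServed (s : ℕ) (r : ℝ → ℕ) (ω : Path) (i : ℕ) : Prop := i ∈ admitted s r ω (i + 1)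

/-- `Q(t, y)`: number of customers present at time `t` with residual service time above `y`. -/
def QLoss (s : ℕ) (r : ℝ → ℕ) (ω : Path) (t y : ℝ) : ℕ :=
  r (t + y) +
    {i : ℕ | arrival s ω i ≤ t ∧ IsServed s r ω i ∧ y < completion s ω i - t}.ncard

/-- `τ_s` for the loss system: the time of the first loss, `∞` if no customer is ever lost. -/
def firstLossTime (s : ℕ) (r : ℝ → ℕ) (ω : Path) : EReal :=
  sInf ((fun i : ℕ => (arrival s ω i : EReal)) '' {i : ℕ | ¬ IsServed s r ω i})

/-- `τ_A`: the first time in `{Δ, 2Δ, …}` at which the profile `q t` of the number of customers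
present at time `t` is in the band, `∞` if there is none. -/
def returnTime (lam C η γ : ℝ) (μV : Measure ℝ) (Δ : ℝ) (s : ℕ) (q : ℝ → ℝ → ℕ) : EReal :=
  sInf ((fun k : ℕ => ((k * Δ : ℝ) : EReal)) ''
    {k : ℕ | 1 ≤ k ∧ InBand lam C η γ μV s (q (k * Δ))})

end

end LossQueue

/-! For a lower bound it suffices to exhibit one scenario of overflow before return whose
probability is at least `exp (-s (I* + ε))`, uniformly in the initial state. Fix `t` slightly above
`θ_∞`, so that `drift` at `t`, which is `ψ_∞'(t)`, exceeds `1`. A customer arriving a time `u`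
before the intended overflow counts only if its service exceeds `u`. The economical way to have many
such customers is to tilt the event `V > u` by `t` and the interarrival times by `-ψ_N(log (e^t
Fbar(u) + F(u)))`. They then arrive at rate `s * tiltRate`, at logarithmic cost `s (t * tiltRate -
ψ_N(...))` per unit time. Integrating over `u` gives more than `s` customers at cost `s (t ψ_∞'(t) -
ψ_∞(t))`, and this tends to `s I*` as `t` decreases to `θ_∞`. Cutting time into finitely many
independent blocks and applying a Cramér bound to each makes this rigorous
(`eventually_le_measureReal_block`, `exists_blockBound_tilted`).

Return to the band must be excluded at every inspection. If `E` is the overflow time, the profile at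
time `t` is tested at the level `y = E - t`, that is, on the customers still present at `E`. Since
`tiltRate` is at least `λ Fbar`, their number keeps up with the band's centre except for a deficit
`λ s ∫_T^∞ Fbar`, caused by the finite horizon `T`. A preliminary ramp of about `4 λ e s` customers
with long services, where `∫_T^∞ Fbar = 2 e`, covers the deficit and leaves a margin of order `s`,
which beats the band width of order `√s`. The ramp costs of order `e log (1 / Fbar(T'))`, where
`∫_{T'}^∞ Fbar = e`. This vanishes with `e` because the light tail gives `Fbar ≥ c (∫ Fbar)²`
(`exists_mul_sq_tailInt_le`, `exists_ramp`).

Until the ramp ends there are too few customers: at times `≥ Δ` only old customers with residual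
service above `Δ` and part of the ramp are present, which is below the band at `y = 0`. The first
interarrival time can therefore be left free, and no initial age matters. `exists_blockScheme` fixes
all constants, `mul_sum_le_ncard_survivors` counts the survivors, and `eventually_le_pathLaw`
combines them. For the loss system, up to its first loss every arrival is admitted as in the
infinite server system, and the scenario forces a loss by time `E`. -/

namespace LossQueue

noncomputable section

set_option linter.unusedSectionVars false

/-! ### A lower bound of Cramér type -/

/-- If the moment generating function of `S` is `exp (n κ)` near `t`, then `S / n` is close to
`κ' t` with probability at least about `exp (-n (t κ' t - κ t))`. -/
lemma eventually_le_measureReal_of_mgf_eq {κ : ℝ → ℝ} {t m ε : ℝ} (hκ : HasDerivAt κ m t)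
    (hε : 0 < ε) {D : Set ℝ} (hD : D ∈ 𝓝 t) :
    ∀ᶠ n : ℕ in atTop, ∀ {Ω : Type} [MeasurableSpace Ω] (P : Measure Ω) [IsProbabilityMeasure P]
      (S : Ω → ℝ), Measurable S →
      (∀ x ∈ D, Integrable (fun ω => Real.exp (x * S ω)) P ∧ mgf S P x = Real.exp (n * κ x)) →
      Real.exp (n * (κ t - t * m) - n * (|t| * ε)) / 2 ≤
        P.real {ω | n * (m - ε) < S ω ∧ S ω < n * (m + ε)} := by
  have h1 : ∀ᶠ x in 𝓝 t, |κ x - κ t - (x - t) * m| ≤ ε / 2 * |x - t| := by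
    have := (hasDerivAt_iff_isLittleO.1 hκ).def (half_pos hε)
    simpa [Real.norm_eq_abs] using this
  obtain ⟨δ, hδ, hball⟩ := Metric.eventually_nhds_iff.1 (h1.and hD)
  set d := δ / 2 with hd
  have hd0 : 0 < d := by positivity
  have hp := hball (y := t + d) (by simp [abs_of_pos hd0]; linarith)
  have hm := hball (y := t - d) (by simp [abs_of_pos hd0]; linarith)
  have ht := hball (y := t) (by simpa using hδ)
  have hp1 : κ (t + d) - κ t ≤ d * m + ε / 2 * d := by
    have := (abs_le.1 hp.1).2
    simp only [add_sub_cancel_left, abs_of_pos hd0] at this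
    linarith
  have hm1 : κ (t - d) - κ t ≤ - (d * m) + ε / 2 * d := by
    have := (abs_le.1 hm.1).2
    have e : t - d - t = -d := by ring
    rw [e, abs_neg, abs_of_pos hd0] at this
    linarith
  -- Relative to `exp (n κ t)`, each of the two Chernoff terms below is at most `exp (-n d ε / 2)`.
  -- Making this at most `1/4` leaves half of the moment generating function on the event `A`.
  have hlim : Tendsto (fun n : ℕ => Real.exp (-(n * (d * ε / 2)))) atTop (𝓝 0) :=
    Real.tendsto_exp_neg_atTop_nhds_zero.comp
      (tendsto_natCast_atTop_atTop.atTop_mul_const (by positivity))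
  filter_upwards [hlim.eventually_le_const (show (0:ℝ) < 1 / 4 by norm_num)] with n hn
  intro Ω _ P _ S hS hmgf
  set A := {ω | n * (m - ε) < S ω ∧ S ω < n * (m + ε)} with hA
  have hAm : MeasurableSet A :=
    (measurableSet_lt measurable_const hS).inter (measurableSet_lt hS measurable_const)
  set c := Real.exp (n * (t * m) + n * (|t| * ε))
  -- Instead of a change of measure: on `A` the exponential is at most `c`, and off `A` it is
  -- dominated by an exponential with parameter `t + d` or `t - d`. Integrating this inequality
  -- bounds `P A` from below.
  have hpt : ∀ ω, Real.exp (t * S ω) ≤ A.indicator (fun _ => c) ω +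
      (Real.exp (-(d * (n * (m + ε)))) * Real.exp ((t + d) * S ω) +
        Real.exp (d * (n * (m - ε))) * Real.exp ((t - d) * S ω)) := by
    intro ω
    by_cases hω : ω ∈ A
    · rw [indicator_of_mem hω]
      have h2 : Real.exp (t * S ω) ≤ c := by
        apply Real.exp_le_exp.2
        obtain ⟨ha, hb⟩ := hω
        have : |t * (S ω - n * m)| ≤ |t| * (n * ε) := by
          rw [abs_mul]
          gcongr
          rw [abs_le]
          constructor <;> nlinarith
        nlinarith [le_abs_self (t * (S ω - n * m))]
      have := Real.exp_pos (-(d * (n * (m + ε))))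
      have := Real.exp_pos ((t + d) * S ω)
      have := Real.exp_pos (d * (n * (m - ε)))
      have := Real.exp_pos ((t - d) * S ω)
      have : 0 ≤ Real.exp (-(d * (n * (m + ε)))) * Real.exp ((t + d) * S ω) +
        Real.exp (d * (n * (m - ε))) * Real.exp ((t - d) * S ω) := by positivity
      linarith
    · rw [indicator_of_notMem hω, zero_add, ← Real.exp_add, ← Real.exp_add]
      have hω' : S ω ≤ n * (m - ε) ∨ n * (m + ε) ≤ S ω := by
        by_contra! h
        exact hω h
      rcases hω' with h | h
      · refine le_trans ?_ (le_add_of_nonneg_left (Real.exp_pos _).le)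
        apply Real.exp_le_exp.2
        nlinarith
      · refine le_trans ?_ (le_add_of_nonneg_right (Real.exp_pos _).le)
        apply Real.exp_le_exp.2
        nlinarith
  have ip := hmgf _ hp.2
  have im := hmgf _ hm.2
  have it := hmgf _ ht.2
  have jp : Integrable (fun ω => Real.exp (-(d * (n * (m + ε)))) * Real.exp ((t + d) * S ω)) P :=
    ip.1.const_mul _
  have jm : Integrable (fun ω => Real.exp (d * (n * (m - ε))) * Real.exp ((t - d) * S ω)) P :=
    im.1.const_mul _
  have jpm : Integrable (fun ω => Real.exp (-(d * (n * (m + ε)))) * Real.exp ((t + d) * S ω) +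
      Real.exp (d * (n * (m - ε))) * Real.exp ((t - d) * S ω)) P := jp.add jm
  have hint := integral_mono it.1 (g := fun ω => A.indicator (fun _ => c) ω +
      (Real.exp (-(d * (n * (m + ε)))) * Real.exp ((t + d) * S ω) +
        Real.exp (d * (n * (m - ε))) * Real.exp ((t - d) * S ω)))
    (((integrable_const c).indicator hAm).add jpm) hpt
  rw [integral_add ((integrable_const c).indicator hAm) jpm, integral_add jp jm, integral_const_mul, integral_const_mul,
    integral_indicator_const _ hAm] at hint
  have e1 : ∫ ω, Real.exp (t * S ω) ∂P = Real.exp (n * κ t) := it.2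
  have e2 : ∫ ω, Real.exp ((t + d) * S ω) ∂P = Real.exp (n * κ (t + d)) := ip.2
  have e3 : ∫ ω, Real.exp ((t - d) * S ω) ∂P = Real.exp (n * κ (t - d)) := im.2
  rw [e1, e2, e3, ← Real.exp_add, ← Real.exp_add, smul_eq_mul] at hint
  have b1 : Real.exp (-(d * (n * (m + ε))) + n * κ (t + d)) ≤ Real.exp (n * κ t) * (1 / 4) := by
    refine le_trans ?_ (mul_le_mul_of_nonneg_left hn (Real.exp_pos _).le)
    rw [← Real.exp_add]
    apply Real.exp_le_exp.2
    have := mul_le_mul_of_nonneg_left hp1 (Nat.cast_nonneg (α := ℝ) n)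
    nlinarith
  have b2 : Real.exp (d * (n * (m - ε)) + n * κ (t - d)) ≤ Real.exp (n * κ t) * (1 / 4) := by
    refine le_trans ?_ (mul_le_mul_of_nonneg_left hn (Real.exp_pos _).le)
    rw [← Real.exp_add]
    apply Real.exp_le_exp.2
    have := mul_le_mul_of_nonneg_left hm1 (Nat.cast_nonneg (α := ℝ) n)
    nlinarith
  have b3 : Real.exp (n * κ t) / 2 ≤ P.real A * c := by linarith
  have b4 : Real.exp (n * (κ t - t * m) - n * (|t| * ε)) = Real.exp (n * κ t) / c := by
    rw [← Real.exp_sub]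
    congr 1
    ring
  rw [b4, div_right_comm, div_le_iff₀ (Real.exp_pos _)]
  exact b3

/-- The lower bound for a block of an i.i.d. sequence. -/
lemma eventually_le_measureReal_block {μ : Measure ℝ} [IsProbabilityMeasure μ] {g : ℝ → ℝ}
    (hg : Measurable g) {t ε : ℝ} (ht : t ∈ interior (integrableExpSet g μ)) (hε : 0 < ε) :
    ∀ᶠ n : ℕ in atTop, ∀ a : ℕ,
      Real.exp (n * (cgf g μ t - t * deriv (cgf g μ) t) - n * (|t| * ε)) / 2 ≤
        (Measure.infinitePi fun _ : ℕ => μ).real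
          {ω | n * (deriv (cgf g μ) t - ε) < ∑ i ∈ Finset.Ico a (a + n), g (ω i) ∧
            ∑ i ∈ Finset.Ico a (a + n), g (ω i) < n * (deriv (cgf g μ) t + ε)} := by
  filter_upwards [eventually_le_measureReal_of_mgf_eq
    (analyticAt_cgf ht).differentiableAt.hasDerivAt hε
    (isOpen_interior.mem_nhds ht)] with n hn a
  refine hn _ (fun ω : ℕ → ℝ => ∑ i ∈ Finset.Ico a (a + n), g (ω i)) (by fun_prop) ?_
  intro x hx
  have hx' : Integrable (fun ω => Real.exp (x * g ω)) μ :=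
    interior_subset (s := integrableExpSet g μ) hx
  have hind : iIndepFun (fun (i : ℕ) (ω : ℕ → ℝ) => g (ω i)) (Measure.infinitePi fun _ : ℕ => μ) :=
    iIndepFun_infinitePi (X := fun _ => g) (fun _ => hg)
  have hmp := fun i : ℕ => measurePreserving_eval_infinitePi (fun _ : ℕ => μ) i
  have hs : (fun ω : ℕ → ℝ => ∑ i ∈ Finset.Ico a (a + n), g (ω i)) =
      ∑ i ∈ Finset.Ico a (a + n), fun ω : ℕ → ℝ => g (ω i) := by
    ext ω
    simp
  constructor
  · have := hind.integrable_exp_mul_sum (t := x) (s := Finset.Ico a (a + n))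
      (fun i => hg.comp (measurable_pi_apply i))
      (fun i _ => (hmp i).integrable_comp_of_integrable hx')
    rw [← hs] at this
    exact this
  · rw [hs, hind.mgf_sum (fun i => hg.comp (measurable_pi_apply i))]
    have : ∀ i : ℕ, mgf (fun ω : ℕ → ℝ => g (ω i)) (Measure.infinitePi fun _ : ℕ => μ) x =
        mgf g μ x := by
      intro i
      have := mgf_map (X := g) (t := x) (hmp i).measurable.aemeasurable (by
        rw [(hmp i).map_eq]
        exact (by fun_prop : Measurable fun ω => Real.exp (x * g ω)).aestronglyMeasurable)
      rw [(hmp i).map_eq] at this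
      exact this.symm
    simp only [this, Finset.prod_const, Nat.card_Ico, add_tsub_cancel_left]
    rw [Real.exp_nat_mul, exp_cgf hx']

/-! ### Independence of blocks of coordinates -/

/-- The σ-algebra generated by the coordinates with index in `S`. -/
abbrev coordSigma (S : Set ℕ) : MeasurableSpace (ℕ → ℝ) :=
  ⨆ i ∈ S, MeasurableSpace.comap (fun ω : ℕ → ℝ => ω i) inferInstance

lemma coordSigma_mono {S T : Set ℕ} (h : S ⊆ T) : coordSigma S ≤ coordSigma T :=
  biSup_mono h

lemma coordSigma_le (S : Set ℕ) : coordSigma S ≤ MeasurableSpace.pi :=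
  iSup₂_le fun i _ => (measurable_pi_apply i).comap_le

lemma measurable_coord {S : Set ℕ} {i : ℕ} (hi : i ∈ S) :
    Measurable[coordSigma S] fun ω : ℕ → ℝ => ω i :=
  Measurable.mono (comap_measurable _)
    (le_biSup (fun i => MeasurableSpace.comap (fun ω : ℕ → ℝ => ω i) inferInstance) hi) le_rfl

lemma measureReal_block_inter {μ : Measure ℝ} [IsProbabilityMeasure μ] {S T : Set ℕ}
    (hST : Disjoint S T) {A B : Set (ℕ → ℝ)} (hA : MeasurableSet[coordSigma S] A)
    (hB : MeasurableSet[coordSigma T] B) :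
    (Measure.infinitePi fun _ : ℕ => μ).real (A ∩ B) =
      (Measure.infinitePi fun _ : ℕ => μ).real A * (Measure.infinitePi fun _ : ℕ => μ).real B := by
  have hind : iIndepFun (fun (i : ℕ) (ω : ℕ → ℝ) => ω i) (Measure.infinitePi fun _ : ℕ => μ) :=
    iIndepFun_infinitePi (X := fun _ => id) (fun _ => measurable_id)
  have := indep_iSup_of_disjoint (fun i => (measurable_pi_apply i).comap_le) hind hST
  have h := (Indep_iff _ _ _).1 this A B hA hB
  simp only [measureReal_def, h, ENNReal.toReal_mul]

/-- The induction carries measurability with respect to the coordinates below `a n`, because this is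
what makes the next block independent of all the previous ones. -/
lemma measureReal_forall_block {μ : Measure ℝ} [IsProbabilityMeasure μ] {a : ℕ → ℕ}
    (ha : Monotone a) {A : ℕ → Set (ℕ → ℝ)} (n : ℕ)
    (hA : ∀ j < n, MeasurableSet[coordSigma (Ico (a j) (a (j + 1)))] (A j)) :
    MeasurableSet[coordSigma (Iio (a n))] {ω | ∀ j < n, ω ∈ A j} ∧
    (Measure.infinitePi fun _ : ℕ => μ).real {ω | ∀ j < n, ω ∈ A j} =
      ∏ j ∈ Finset.range n, (Measure.infinitePi fun _ : ℕ => μ).real (A j) := by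
  induction n with
  | zero => simp
  | succ n ih =>
    obtain ⟨h1, h2⟩ := ih fun j hj => hA j (by omega)
    have e : {ω | ∀ j < n + 1, ω ∈ A j} = {ω | ∀ j < n, ω ∈ A j} ∩ A n := by
      ext ω
      simp only [mem_ofPred_eq, mem_inter_iff, Nat.lt_succ_iff_lt_or_eq, or_imp, forall_and,
        forall_eq]
    rw [e]
    constructor
    · refine MeasurableSet.inter ?_ ?_
      · exact coordSigma_mono (Iio_subset_Iio (ha (Nat.le_succ n))) _ h1
      · exact coordSigma_mono (fun i hi => hi.2) _ (hA n (Nat.lt_succ_self n))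
    · rw [measureReal_block_inter ?_ h1 (hA n (Nat.lt_succ_self n)), h2, Finset.prod_range_succ]
      rw [Set.disjoint_left]
      exact fun i hi hi' => absurd hi'.1 (not_le.2 hi)

/-! ### The service law -/

section Service

variable {μV : Measure ℝ} [IsProbabilityMeasure μV] {f : ℝ → ℝ}

lemma Fbar_eq_measureReal (y : ℝ) : Fbar μV y = μV.real (Ioi y) := by
  rw [Fbar, cdf_eq_real, ← compl_Iic, measureReal_compl measurableSet_Iic]
  simp

lemma Fbar_nonneg (y : ℝ) : 0 ≤ Fbar μV y := by
  rw [Fbar_eq_measureReal]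
  exact measureReal_nonneg

lemma Fbar_le_one (y : ℝ) : Fbar μV y ≤ 1 := by
  rw [Fbar_eq_measureReal]
  exact measureReal_le_one

lemma antitone_Fbar : Antitone (Fbar μV) := fun _ _ h =>
  sub_le_sub_left (monotone_cdf μV h) 1

lemma measurable_Fbar : Measurable (Fbar μV) := antitone_Fbar.measurable

lemma Fbar_zero (hV : ServiceLaw μV f) : Fbar μV 0 = 1 := by
  have h0 : μV (Iic 0) = 0 := by
    rw [← Iio_union_right, measure_union_null_iff]
    refine ⟨hV.nonneg, ?_⟩
    rw [hV.density, withDensity_apply _ (measurableSet_singleton _)]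
    simp
  simp [Fbar, cdf_eq_real, measureReal_def, h0]

/-- The hazard rate bound makes the tail drop by a factor at each doubling. -/
lemma exists_Fbar_two_mul_le (hV : ServiceLaw μV f) :
    ∃ y₀ : ℝ, 1 ≤ y₀ ∧ ∀ y, y₀ ≤ y → Fbar μV (2 * y) ≤ Fbar μV y / 8 := by
  -- On `(y, 2y]` a hazard above `14 / u ≥ 7 / y` gives density at least `7 Fbar(2y) / y`, hence
  -- mass at least `7 Fbar(2y)`, so that `Fbar(y) ≥ 8 Fbar(2y)`.
  have h14 : ∀ᶠ y : ℝ in atTop, (14 : ENNReal) < ENNReal.ofReal y * hazard μV f y :=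
    hV.light_tail.eventually (lt_mem_nhds (by simp))
  obtain ⟨y₁, hy₁⟩ := eventually_atTop.1 h14
  refine ⟨max y₁ 1, le_max_right _ _, fun y hy => ?_⟩
  have hy1 : 1 ≤ y := (le_max_right _ _).trans hy
  have hyy : y₁ ≤ y := (le_max_left _ _).trans hy
  rcases (Fbar_nonneg (μV := μV) (2 * y)).eq_or_lt with h0 | hpos
  · rw [← h0]
    exact div_nonneg (Fbar_nonneg y) (by norm_num)
  have hf : ∀ u ∈ Ioc y (2 * y), 7 * Fbar μV (2 * y) / y ≤ f u := by
    intro u hu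
    have hFu : Fbar μV (2 * y) ≤ Fbar μV u := antitone_Fbar hu.2
    have hFu0 : 0 < Fbar μV u := hpos.trans_le hFu
    have hu0 : 0 < u := by linarith [hu.1]
    have h := (hy₁ u (hyy.trans hu.1.le)).le
    rw [hazard, if_neg hFu0.ne', ← ENNReal.ofReal_mul hu0.le,
      show (14 : ENNReal) = ENNReal.ofReal 14 by norm_num,
      ENNReal.ofReal_le_ofReal_iff (mul_nonneg hu0.le (div_nonneg (hV.density_nonneg u) hFu0.le)),
      ← mul_div_assoc, le_div_iff₀ hFu0] at h
    rw [div_le_iff₀ (by linarith)]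
    have : u * f u ≤ 2 * y * f u := mul_le_mul_of_nonneg_right hu.2 (hV.density_nonneg u)
    linarith
  have hm : ENNReal.ofReal (7 * Fbar μV (2 * y)) ≤ μV (Ioc y (2 * y)) := by
    have e : μV (Ioc y (2 * y)) = ∫⁻ u in Ioc y (2 * y), ENNReal.ofReal (f u) := by
      conv_lhs => rw [hV.density]
      exact withDensity_apply _ measurableSet_Ioc
    rw [e]
    calc ENNReal.ofReal (7 * Fbar μV (2 * y))
        = ∫⁻ _ in Ioc y (2 * y), ENNReal.ofReal (7 * Fbar μV (2 * y) / y) := by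
          rw [setLIntegral_const, Real.volume_Ioc, ← ENNReal.ofReal_mul (by positivity)]
          congr 1
          field_simp
          ring
      _ ≤ _ := setLIntegral_mono (by have := hV.measurable; fun_prop)
          fun u hu => ENNReal.ofReal_le_ofReal (hf u hu)
  have hm' : 7 * Fbar μV (2 * y) ≤ μV.real (Ioc y (2 * y)) :=
    (ENNReal.ofReal_le_iff_le_toReal (measure_ne_top _ _)).1 hm
  have hsplit : Fbar μV y = μV.real (Ioc y (2 * y)) + Fbar μV (2 * y) := by
    have hd : Disjoint (Ioc y (2 * y)) (Ioi (2 * y)) :=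
      Set.disjoint_left.2 fun x hx hx' => absurd hx.2 (not_le.2 hx')
    rw [Fbar_eq_measureReal, Fbar_eq_measureReal, ← measureReal_union hd measurableSet_Ioi,
      Ioc_union_Ioi_eq_Ioi (by linarith)]
  linarith

/-- The tail decays at least like a cube. -/
lemma exists_Fbar_le_cube (hV : ServiceLaw μV f) :
    ∃ y₀ : ℝ, 1 ≤ y₀ ∧ ∀ y, y₀ ≤ y → ∀ z, y ≤ z →
      Fbar μV z ≤ 8 * y ^ 3 * Fbar μV y * z ^ (-3 : ℝ) := by
  obtain ⟨y₀, hy₀, h⟩ := exists_Fbar_two_mul_le hV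
  refine ⟨y₀, hy₀, fun y hy z hz => ?_⟩
  have hy0 : 0 < y := by linarith
  have hz0 : 0 < z := by linarith
  have hiter : ∀ k : ℕ, Fbar μV (2 ^ k * y) ≤ Fbar μV y / 8 ^ k := by
    intro k
    induction k with
    | zero => simp
    | succ k ih =>
      have h1 : y₀ ≤ 2 ^ k * y := hy.trans (le_mul_of_one_le_left hy0.le (one_le_pow₀ one_le_two))
      calc Fbar μV (2 ^ (k + 1) * y) = Fbar μV (2 * (2 ^ k * y)) := by ring_nf
        _ ≤ Fbar μV (2 ^ k * y) / 8 := h _ h1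
        _ ≤ Fbar μV y / 8 ^ k / 8 := by gcongr
        _ = Fbar μV y / 8 ^ (k + 1) := by rw [pow_succ, div_div]
  -- With `2^k ≤ z / y < 2^(k+1)`, the `k` doublings yield the factor `8^(-k) = (2^k)^(-3)`,
  -- comparable to `(z / y)^(-3)`.
  obtain ⟨k, hk1, hk2⟩ := exists_nat_pow_near ((one_le_div hy0).2 hz) one_lt_two
  rw [le_div_iff₀ hy0] at hk1
  rw [div_lt_iff₀ hy0] at hk2
  have h8 : Fbar μV z ≤ Fbar μV y / 8 ^ k := (antitone_Fbar hk1).trans (hiter k)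
  refine h8.trans ?_
  have hrp : z ^ (-3 : ℝ) = (z ^ 3)⁻¹ := by
    rw [Real.rpow_neg hz0.le]
    norm_cast
  rw [hrp, ← div_eq_mul_inv, div_le_div_iff₀ (by positivity) (by positivity)]
  have hcube : z ^ 3 ≤ 8 * y ^ 3 * 8 ^ k := by
    calc z ^ 3 ≤ (2 ^ (k + 1) * y) ^ 3 := by gcongr
      _ = 8 * y ^ 3 * 8 ^ k := by
        rw [mul_pow, ← pow_mul, show (8 : ℝ) ^ k = 2 ^ (3 * k) by rw [pow_mul]; norm_num]
        ring
  calc Fbar μV y * z ^ 3 ≤ Fbar μV y * (8 * y ^ 3 * 8 ^ k) := by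
        gcongr
        exact Fbar_nonneg y
    _ = 8 * y ^ 3 * Fbar μV y * 8 ^ k := by ring

lemma integrableOn_Fbar (hV : ServiceLaw μV f) (a : ℝ) : IntegrableOn (Fbar μV) (Ioi a) := by
  obtain ⟨y₀, hy₀, h⟩ := exists_Fbar_le_cube hV
  have h1 : IntegrableOn (Fbar μV) (Ioi y₀) := by
    refine Integrable.mono' (((integrableOn_Ioi_rpow_of_lt (a := -3) (by norm_num)
      (show 0 < y₀ by linarith)).const_mul (8 * y₀ ^ 3 * Fbar μV y₀)))
      measurable_Fbar.aestronglyMeasurable ?_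
    refine (ae_restrict_iff' measurableSet_Ioi).2 (ae_of_all _ fun z hz => ?_)
    rw [Real.norm_of_nonneg (Fbar_nonneg z)]
    exact h y₀ le_rfl z (le_of_lt hz)
  rcases le_total a y₀ with hay | hay
  · rw [← Ioc_union_Ioi_eq_Ioi hay]
    refine IntegrableOn.union ?_ h1
    exact (antitone_Fbar.antitoneOn _).integrableOn_isCompact isCompact_Icc |>.mono_set
      Ioc_subset_Icc_self
  · exact h1.mono_set (Ioi_subset_Ioi hay)

lemma intervalIntegrable_Fbar (a b : ℝ) : IntervalIntegrable (Fbar μV) volume a b :=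
  antitone_Fbar.intervalIntegrable

lemma tailInt_nonneg (y : ℝ) : 0 ≤ tailInt μV y :=
  integral_nonneg fun _ => Fbar_nonneg _

lemma tailInt_sub_tailInt (hV : ServiceLaw μV f) (a b : ℝ) :
    tailInt μV a - tailInt μV b = ∫ u in a..b, Fbar μV u :=
  intervalIntegral.integral_Ioi_sub_Ioi' (integrableOn_Fbar hV a) (integrableOn_Fbar hV b)

lemma tailInt_sub_le (hV : ServiceLaw μV f) {a b : ℝ} (hab : a ≤ b) :
    tailInt μV a - tailInt μV b ≤ (b - a) * Fbar μV a := by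
  rw [tailInt_sub_tailInt hV]
  have := intervalIntegral.integral_mono_on hab (intervalIntegrable_Fbar a b)
    (intervalIntegrable_const (c := Fbar μV a)) fun x hx => antitone_Fbar hx.1
  simpa using this

lemma le_tailInt_sub (hV : ServiceLaw μV f) {a b : ℝ} (hab : a ≤ b) :
    (b - a) * Fbar μV b ≤ tailInt μV a - tailInt μV b := by
  rw [tailInt_sub_tailInt hV]
  have := intervalIntegral.integral_mono_on hab (intervalIntegrable_const (c := Fbar μV b))
    (intervalIntegrable_Fbar a b) fun x hx => antitone_Fbar hx.2
  simpa using this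

lemma antitone_tailInt (hV : ServiceLaw μV f) : Antitone (tailInt μV) := fun a b hab => by
  have := le_tailInt_sub hV hab
  have := mul_nonneg (sub_nonneg.2 hab) (Fbar_nonneg (μV := μV) b)
  linarith

lemma continuous_tailInt (hV : ServiceLaw μV f) : Continuous (tailInt μV) := by
  have : tailInt μV = fun y => tailInt μV 0 - ∫ u in (0 : ℝ)..y, Fbar μV u := by
    ext y
    rw [← tailInt_sub_tailInt hV]
    ring
  rw [this]
  exact continuous_const.sub
    (intervalIntegral.continuous_primitive (fun a b => intervalIntegrable_Fbar a b) 0)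

lemma tendsto_tailInt (hV : ServiceLaw μV f) : Tendsto (tailInt μV) atTop (𝓝 0) := by
  have h := intervalIntegral_tendsto_integral_Ioi 0 (integrableOn_Fbar hV 0) tendsto_id
  have h2 : Tendsto (fun y : ℝ => tailInt μV 0 - ∫ u in (0 : ℝ)..y, Fbar μV u) atTop
      (𝓝 (tailInt μV 0 - tailInt μV 0)) := tendsto_const_nhds.sub h
  rw [sub_self] at h2
  refine h2.congr fun y => ?_
  rw [← tailInt_sub_tailInt hV]
  ring

lemma exists_Fbar_pos (hV : ServiceLaw μV f) : ∃ y : ℝ, 0 < y ∧ 0 < Fbar μV y := by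
  have h : ContinuousWithinAt (cdf μV) (Ici 0) 0 := (cdf μV).right_continuous 0
  have h0 : cdf μV 0 < 1 := by
    have := Fbar_zero hV
    rw [Fbar] at this
    linarith
  have h1 : ∀ᶠ y in 𝓝[>] (0 : ℝ), cdf μV y < 1 :=
    (h.mono Ioi_subset_Ici_self).eventually_lt_const h0
  obtain ⟨y, hy, hy0⟩ := (h1.and self_mem_nhdsWithin).exists
  exact ⟨y, hy0, by rw [Fbar]; linarith⟩

lemma tailInt_lt_tailInt_zero (hV : ServiceLaw μV f) {y : ℝ} (hy : 0 < y) :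
    tailInt μV y < tailInt μV 0 := by
  obtain ⟨x, hx, hFx⟩ := exists_Fbar_pos hV
  have h1 := le_tailInt_sub hV (lt_min hx hy).le
  have h2 := antitone_tailInt hV (min_le_right x y)
  have h3 : 0 < (min x y - 0) * Fbar μV (min x y) :=
    mul_pos (by simp [hx, hy]) (hFx.trans_le (antitone_Fbar (min_le_left x y)))
  linarith

lemma exists_tailInt_eq (hV : ServiceLaw μV f) {v : ℝ} (hv : 0 < v) (hv' : v ≤ tailInt μV 0) :
    ∃ y : ℝ, 0 ≤ y ∧ tailInt μV y = v := by
  obtain ⟨b, hb, hb0⟩ := (((tendsto_tailInt hV).eventually_lt_const hv).and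
    (eventually_ge_atTop 0)).exists
  obtain ⟨y, hy, rfl⟩ := intermediate_value_Icc' hb0 (continuous_tailInt hV).continuousOn
    ⟨hb.le, hv'⟩
  exact ⟨y, hy.1, rfl⟩

lemma Fbar_pos_of_tailInt_pos {y : ℝ} (h : 0 < tailInt μV y) : 0 < Fbar μV y := by
  refine (Fbar_nonneg y).lt_of_ne' fun h0 => h.ne' ?_
  refine setIntegral_eq_zero_of_forall_eq_zero fun u hu => ?_
  exact le_antisymm (h0 ▸ antitone_Fbar (le_of_lt hu)) (Fbar_nonneg u)

/-- The light tail assumption: the tail is at least of the order of the square of its integral. -/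
lemma exists_mul_sq_tailInt_le (hV : ServiceLaw μV f) :
    ∃ c : ℝ, 0 < c ∧ ∀ y : ℝ, 0 ≤ y → c * tailInt μV y ^ 2 ≤ Fbar μV y := by
  obtain ⟨y₀, hy₀, h⟩ := exists_Fbar_le_cube hV
  have hlarge : ∀ y, y₀ ≤ y → tailInt μV y ≤ 4 * y * Fbar μV y := by
    intro y hy
    have hy0 : 0 < y := by linarith
    calc tailInt μV y ≤ ∫ z in Ioi y, 8 * y ^ 3 * Fbar μV y * z ^ (-3 : ℝ) :=
          setIntegral_mono_on (integrableOn_Fbar hV y)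
            ((integrableOn_Ioi_rpow_of_lt (by norm_num) hy0).const_mul _) measurableSet_Ioi
            fun z hz => h y hy z (le_of_lt hz)
      _ = 4 * y * Fbar μV y := by
          rw [integral_const_mul, integral_Ioi_rpow_of_lt (by norm_num) hy0,
            show (-3 + 1 : ℝ) = -2 by norm_num,
            show y ^ (-2 : ℝ) = (y ^ 2)⁻¹ by rw [Real.rpow_neg hy0.le]; norm_cast]
          field_simp
          ring
  set m := tailInt μV 0
  have hm : 0 ≤ m := tailInt_nonneg 0
  -- One summand for each regime. For `y ≥ y₀`, `tailInt ≤ 4 y Fbar` and `y * tailInt ≤ 32 y₀³`. For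
  -- `y ≤ y₀`, `tailInt ≤ 5 y₀ Fbar` and `tailInt ≤ m`.
  set d := 128 * y₀ ^ 3 + 5 * y₀ * m
  have hd : 0 < d := by positivity
  refine ⟨d⁻¹, by positivity, fun y hy => ?_⟩
  rw [inv_mul_le_iff₀ hd]
  have hF := Fbar_nonneg (μV := μV) y
  have htn := tailInt_nonneg (μV := μV) y
  rcases le_total y₀ y with hyy | hyy
  · have hy0 : 0 < y := by linarith
    have h1 := hlarge y hyy
    have h2 := h y₀ le_rfl y hyy
    have h3 : tailInt μV y * y ^ 2 ≤ 32 * y₀ ^ 3 := by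
      have hrp : y ^ (-3 : ℝ) = (y ^ 3)⁻¹ := by
        rw [Real.rpow_neg hy0.le]
        norm_cast
      rw [hrp, ← div_eq_mul_inv, le_div_iff₀ (by positivity)] at h2
      have h4 : 8 * y₀ ^ 3 * Fbar μV y₀ ≤ 8 * y₀ ^ 3 :=
        mul_le_of_le_one_right (by positivity) (Fbar_le_one _)
      have := mul_le_mul_of_nonneg_right h1 (sq_nonneg y)
      nlinarith
    have h5 : tailInt μV y * y ≤ 32 * y₀ ^ 3 :=
      le_trans (mul_le_mul_of_nonneg_left (by nlinarith) htn) h3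
    calc tailInt μV y ^ 2 ≤ tailInt μV y * (4 * y * Fbar μV y) := by
          rw [sq]
          gcongr
      _ = 4 * (tailInt μV y * y) * Fbar μV y := by ring
      _ ≤ 4 * (32 * y₀ ^ 3) * Fbar μV y := by gcongr
      _ ≤ d * Fbar μV y := by
          gcongr
          have : 0 ≤ 5 * y₀ * m := by positivity
          simp only [d]
          linarith
  · have h1 := tailInt_sub_le hV hyy
    have h2 := hlarge y₀ le_rfl
    have h3 : Fbar μV y₀ ≤ Fbar μV y := antitone_Fbar hyy
    have h4 : tailInt μV y ≤ 5 * y₀ * Fbar μV y := by nlinarith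
    have h5 : tailInt μV y ≤ m := antitone_tailInt hV hy
    calc tailInt μV y ^ 2 ≤ m * (5 * y₀ * Fbar μV y) := by
          rw [sq]
          gcongr
      _ = 5 * y₀ * m * Fbar μV y := by ring
      _ ≤ d * Fbar μV y := by
          gcongr
          have : 0 ≤ 128 * y₀ ^ 3 := by positivity
          simp only [d]
          linarith

lemma integral_eq_tailInt_zero (hV : ServiceLaw μV f) : ∫ y, y ∂μV = tailInt μV 0 := by
  have hnn : 0 ≤ᵐ[μV] (id : ℝ → ℝ) := by
    have : ∀ᵐ y ∂μV, y ∉ Iio (0 : ℝ) := measure_eq_zero_iff_ae_notMem.1 hV.nonneg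
    filter_upwards [this] with y hy
    exact not_lt.1 hy
  have hlay := lintegral_eq_lintegral_meas_lt μV hnn measurable_id.aemeasurable
  have hint : Integrable (id : ℝ → ℝ) μV := by
    refine ⟨measurable_id.aestronglyMeasurable, ?_⟩
    rw [hasFiniteIntegral_iff_ofReal hnn, hlay]
    have := (integrableOn_Fbar hV 0).lintegral_lt_top
    refine lt_of_eq_of_lt (lintegral_congr fun t => ?_) this
    rw [Fbar_eq_measureReal, ofReal_measureReal]
    rfl
  have := hint.integral_eq_integral_meas_lt hnn
  simp only [id] at this
  rw [this, tailInt]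
  simp only [Fbar_eq_measureReal]
  rfl

/-- All that is needed about the shape of the band: its half width is at most `√s * M` uniformly in
`y`, negligible against deviations of order `s`. -/
lemma exists_abs_mul_xi_le (hV : ServiceLaw μV f) {lam η : ℝ} (hlam : 0 < lam) (hη : 0 < η)
    (C γ : ℝ) : ∃ M : ℝ, 0 ≤ M ∧ ∀ y : ℝ, 0 ≤ y → |C * xi lam η γ μV y| ≤ M := by
  have hnn : ∀ y, 0 ≤ nu lam η μV y := fun y =>
    Real.rpow_nonneg (mul_nonneg hlam.le (tailInt_nonneg y)) _
  have hanti : Antitone (nu lam η μV) := fun x y hxy =>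
    Real.rpow_le_rpow (mul_nonneg hlam.le (tailInt_nonneg y))
      (mul_le_mul_of_nonneg_left (antitone_tailInt hV hxy) hlam.le) (by positivity)
  have hI : ∀ y : ℝ, 0 ≤ y →
      ∫ u in Ioi y, nu lam η μV u ≤ ∫ u in Ioi (0 : ℝ), nu lam η μV u := by
    intro y hy
    by_cases h : IntegrableOn (nu lam η μV) (Ioi 0)
    · exact setIntegral_mono_set h (ae_of_all _ hnn) (Ioi_subset_Ioi hy).eventuallyLE
    -- Integrability of `ν` need not be decided: being antitone, `ν` is integrable on compacts, so
    -- failure on `(0, ∞)` means failure on `(y, ∞)`, and then both integrals are `0` by convention.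
    · have h' : ¬ IntegrableOn (nu lam η μV) (Ioi y) := fun hy' => h (by
        rw [← Ioc_union_Ioi_eq_Ioi hy]
        exact ((hanti.antitoneOn _).integrableOn_isCompact isCompact_Icc |>.mono_set
          Ioc_subset_Icc_self).union hy')
      rw [integral_undef h, integral_undef h']
  set I := ∫ u in Ioi (0 : ℝ), nu lam η μV u
  have hI0 : 0 ≤ I := integral_nonneg hnn
  refine ⟨|C| * (nu lam η μV 0 + |γ| * I), mul_nonneg (abs_nonneg _)
    (add_nonneg (hnn 0) (mul_nonneg (abs_nonneg _) hI0)), fun y hy => ?_⟩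
  rw [abs_mul]
  gcongr
  refine (abs_add_le _ _).trans ?_
  rw [abs_mul, abs_of_nonneg (hnn y), abs_of_nonneg (integral_nonneg hnn)]
  gcongr
  · exact hanti hy
  · exact hI y hy

end Service

/-! ### The arrival law -/

section Arrival

variable {lam : ℝ} {μU : Measure ℝ} [IsProbabilityMeasure μU]

lemma ArrivalLaw.ae_nonneg (hU : ArrivalLaw lam μU) : ∀ᵐ u ∂μU, 0 ≤ u := by
  filter_upwards [measure_eq_zero_iff_ae_notMem.1 hU.nonneg] with u hu
  exact not_lt.1 hu

lemma ArrivalLaw.integrable (hU : ArrivalLaw lam μU) : Integrable (fun u : ℝ => u) μU :=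
  Integrable.of_integral_ne_zero (by rw [hU.mean]; exact (one_div_pos.2 hU.rate_pos).ne')

lemma ArrivalLaw.mem_integrableExpSet (hU : ArrivalLaw lam μU) {x : ℝ} (hx : x ≤ 0) :
    x ∈ integrableExpSet id μU := by
  refine Integrable.mono' (integrable_const (1 : ℝ)) (by fun_prop) ?_
  filter_upwards [hU.ae_nonneg] with u hu
  rw [Real.norm_of_nonneg (Real.exp_pos _).le]
  exact Real.exp_le_one_iff.2 (mul_nonpos_of_nonpos_of_nonneg hx hu)

lemma ArrivalLaw.mem_interior (hU : ArrivalLaw lam μU) {x : ℝ} (hx : x ≤ 0) :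
    x ∈ interior (integrableExpSet id μU) := by
  rcases hx.eq_or_lt with rfl | hx
  · exact hU.exp_moments
  · exact interior_maximal (fun y (hy : y < 0) => hU.mem_integrableExpSet hy.le) isOpen_Iio hx

/-- Strictness holds because the interarrival time is nonnegative with positive mean, hence not
almost surely `0`. The resulting injectivity makes the chosen inverse in `psiN` the true inverse. -/
lemma ArrivalLaw.cgf_lt_cgf (hU : ArrivalLaw lam μU) {x y : ℝ} (hx : x ∈ integrableExpSet id μU)
    (hy : y ∈ integrableExpSet id μU) (hxy : x < y) : cgf id μU x < cgf id μU y := by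
  refine Real.log_lt_log (mgf_pos hx) ?_
  have hle : (fun u => Real.exp (x * id u)) ≤ᵐ[μU] fun u => Real.exp (y * id u) := by
    filter_upwards [hU.ae_nonneg] with u hu
    exact Real.exp_le_exp.2 (mul_le_mul_of_nonneg_right hxy.le hu)
  refine lt_of_le_of_ne (integral_mono_ae hx hy hle) fun h => ?_
  have h1 : ∀ᵐ u ∂μU, u = 0 := by
    filter_upwards [(integral_eq_iff_of_ae_le hx hy hle).1 h] with u hu
    have h4 : x * u = y * u := Real.exp_injective hu
    have h3 : (y - x) * u = 0 := by linarith
    exact (mul_eq_zero.1 h3).resolve_left (sub_pos.2 hxy).ne'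
  have h2 := hU.mean
  rw [integral_congr_ae h1, integral_zero] at h2
  exact (one_div_pos.2 hU.rate_pos).ne h2

lemma ArrivalLaw.neg_psiN_mem (hU : ArrivalLaw lam μU) (θ : ℝ) :
    -psiN μU θ ∈ integrableExpSet id μU := by
  rw [psiN, neg_neg]
  exact Function.invFunOn_mem (hU.dom θ)

lemma ArrivalLaw.cgf_neg_psiN (hU : ArrivalLaw lam μU) (θ : ℝ) :
    cgf id μU (-psiN μU θ) = -θ := by
  rw [psiN, neg_neg]
  exact Function.invFunOn_eq (hU.dom θ)

lemma ArrivalLaw.psiN_strictMono (hU : ArrivalLaw lam μU) : StrictMono (psiN μU) := by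
  intro a b hab
  by_contra! h
  rcases h.eq_or_lt with h | h
  · have h1 := hU.cgf_neg_psiN a
    rw [← h, hU.cgf_neg_psiN b] at h1
    linarith
  · have h1 := hU.cgf_lt_cgf (hU.neg_psiN_mem a) (hU.neg_psiN_mem b) (neg_lt_neg h)
    rw [hU.cgf_neg_psiN, hU.cgf_neg_psiN] at h1
    linarith

lemma ArrivalLaw.psiN_zero (hU : ArrivalLaw lam μU) : psiN μU 0 = 0 := by
  have h0 := hU.cgf_neg_psiN 0
  have hm := hU.neg_psiN_mem 0
  have hz : (0 : ℝ) ∈ integrableExpSet id μU := hU.mem_integrableExpSet le_rfl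
  have hc : cgf id μU 0 = 0 := cgf_zero
  rcases lt_trichotomy (psiN μU 0) 0 with h | h | h
  · have := hU.cgf_lt_cgf hz hm (neg_pos.2 h)
    linarith
  · exact h
  · have := hU.cgf_lt_cgf hm hz (neg_lt_zero.2 h)
    linarith

lemma ArrivalLaw.psiN_nonneg (hU : ArrivalLaw lam μU) {θ : ℝ} (hθ : 0 ≤ θ) : 0 ≤ psiN μU θ := by
  rw [← hU.psiN_zero]
  exact hU.psiN_strictMono.monotone hθ

lemma ArrivalLaw.differentiable (hU : ArrivalLaw lam μU) : Differentiable ℝ (psiN μU) :=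
  hU.smooth.differentiable (by norm_num)

lemma ArrivalLaw.continuous_deriv (hU : ArrivalLaw lam μU) : Continuous (deriv (psiN μU)) :=
  hU.smooth.continuous_deriv (by norm_num)

lemma ArrivalLaw.deriv_strictMono (hU : ArrivalLaw lam μU) : StrictMono (deriv (psiN μU)) := by
  have := hU.strictConvex.strictMonoOn_deriv fun x _ => hU.differentiable x
  exact strictMonoOn_univ.1 this

/-- Differentiate `κ⁰(-ψ_N(θ)) = -θ`. In words: under the tilt by `-ψ_N(θ)` the mean interarrival
time is the reciprocal of the rate `ψ_N'(θ)`. -/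
lemma ArrivalLaw.deriv_cgf_mul_deriv_psiN (hU : ArrivalLaw lam μU) {θ : ℝ} (hθ : 0 ≤ θ) :
    deriv (cgf id μU) (-psiN μU θ) * deriv (psiN μU) θ = 1 := by
  have h1 := (analyticAt_cgf (hU.mem_interior (neg_nonpos.2
    (hU.psiN_nonneg hθ)))).differentiableAt.hasDerivAt
  have h2 := h1.comp θ (hU.differentiable θ).hasDerivAt.neg
  have h3 : cgf id μU ∘ (fun x => -psiN μU x) = fun x => -x := by
    ext x
    exact hU.cgf_neg_psiN x
  have h4 := h2.unique (show HasDerivAt (cgf id μU ∘ (fun x => -psiN μU x)) (-1) θ by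
    rw [h3]
    exact (hasDerivAt_id θ).neg)
  linarith

lemma ArrivalLaw.deriv_psiN_zero (hU : ArrivalLaw lam μU) : deriv (psiN μU) 0 = lam := by
  have h := hU.deriv_cgf_mul_deriv_psiN le_rfl
  rw [hU.psiN_zero, neg_zero, deriv_cgf_zero hU.exp_moments] at h
  have hm := hU.mean
  simp only [id, probReal_univ, div_one] at h
  rw [hm] at h
  have := hU.rate_pos
  field_simp at h
  exact h

lemma ArrivalLaw.le_deriv_psiN (hU : ArrivalLaw lam μU) {θ : ℝ} (hθ : 0 ≤ θ) :
    lam ≤ deriv (psiN μU) θ := by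
  rw [← hU.deriv_psiN_zero]
  exact hU.deriv_strictMono.monotone hθ

lemma ArrivalLaw.psiN_le (hU : ArrivalLaw lam μU) {x θ : ℝ} (hx : 0 ≤ x) (hxθ : x ≤ θ) :
    psiN μU x ≤ deriv (psiN μU) θ * x := by
  have h := Convex.image_sub_le_mul_sub_of_deriv_le (convex_Icc 0 θ)
    (hU.differentiable.continuous.continuousOn) (hU.differentiable.differentiableOn)
    (C := deriv (psiN μU) θ) (fun y hy => hU.deriv_strictMono.monotone (by
      rw [interior_Icc] at hy
      exact hy.2.le)) 0 ⟨le_rfl, hx.trans hxθ⟩ x ⟨hx, hxθ⟩ hx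
  rwa [hU.psiN_zero, sub_zero, sub_zero] at h

end Arrival

/-! ### The limiting cumulant function -/

/-- The normalizing constant of the indicator of an event of probability `x` tilted by `θ`. -/
def tiltMass (θ x : ℝ) : ℝ := Real.exp θ * x + (1 - x)

/-- The rate at which, under the tilt by `θ`, those customers arrive for which an event of
probability `x` occurs. -/
def tiltRate (μU : Measure ℝ) (θ x : ℝ) : ℝ :=
  deriv (psiN μU) (Real.log (tiltMass θ x)) * (Real.exp θ * x / tiltMass θ x)

/-- The derivative of `psiInf`. -/
def drift (μU μV : Measure ℝ) (θ : ℝ) : ℝ := ∫ u in Ioi (0 : ℝ), tiltRate μU θ (Fbar μV u)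

lemma psiInf_eq (μU μV : Measure ℝ) (θ : ℝ) :
    psiInf μU μV θ = ∫ u in Ioi (0 : ℝ), psiN μU (Real.log (tiltMass θ (Fbar μV u))) := by
  simp only [psiInf, tiltMass, Fbar, sub_sub_cancel]

section TiltMass

variable {θ x : ℝ}

lemma tiltMass_pos (θ : ℝ) {x : ℝ} (hx : x ∈ Icc (0 : ℝ) 1) : 0 < tiltMass θ x := by
  rw [tiltMass]
  rcases hx.1.eq_or_lt with h | h
  · rw [← h]
    norm_num
  · have := mul_pos (Real.exp_pos θ) h
    linarith [hx.2]

lemma one_le_tiltMass (hθ : 0 ≤ θ) (hx : 0 ≤ x) : 1 ≤ tiltMass θ x := by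
  rw [tiltMass]
  nlinarith [Real.one_le_exp hθ]

lemma tiltMass_le_exp (hθ : 0 ≤ θ) (hx : x ≤ 1) : tiltMass θ x ≤ Real.exp θ := by
  rw [tiltMass]
  nlinarith [Real.one_le_exp hθ]

lemma log_tiltMass_nonneg (hθ : 0 ≤ θ) (hx : 0 ≤ x) : 0 ≤ Real.log (tiltMass θ x) :=
  Real.log_nonneg (one_le_tiltMass hθ hx)

lemma log_tiltMass_le (hθ : 0 ≤ θ) (hx : x ∈ Icc (0 : ℝ) 1) : Real.log (tiltMass θ x) ≤ θ :=
  (Real.log_le_iff_le_exp (tiltMass_pos θ hx)).2 (tiltMass_le_exp hθ hx.2)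

lemma abs_log_tiltMass_le {b : ℝ} (hθ : |θ| ≤ b) (hx : x ∈ Icc (0 : ℝ) 1) :
    |Real.log (tiltMass θ x)| ≤ b ∧ Real.exp (-b) ≤ tiltMass θ x := by
  obtain ⟨h1, h2⟩ := abs_le.1 hθ
  have hb : 0 ≤ b := (abs_nonneg θ).trans hθ
  have h3 : Real.exp (-b) ≤ tiltMass θ x := by
    rw [tiltMass]
    nlinarith [Real.exp_le_exp.2 h1, Real.exp_le_one_iff.2 (neg_nonpos.2 hb), hx.1, hx.2]
  have h4 : tiltMass θ x ≤ Real.exp b := by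
    rw [tiltMass]
    nlinarith [Real.exp_le_exp.2 h2, Real.one_le_exp hb, hx.1, hx.2]
  have hp := tiltMass_pos θ hx
  exact ⟨abs_le.2 ⟨(Real.le_log_iff_exp_le hp).2 h3, (Real.log_le_iff_le_exp hp).2 h4⟩, h3⟩

lemma le_exp_mul_div_tiltMass (hθ : 0 ≤ θ) (hx : x ∈ Icc (0 : ℝ) 1) :
    x ≤ Real.exp θ * x / tiltMass θ x := by
  rw [le_div_iff₀ (tiltMass_pos θ hx), mul_comm]
  exact mul_le_mul_of_nonneg_right (tiltMass_le_exp hθ hx.2) hx.1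

lemma log_tiltMass_mono {y : ℝ} (hθ : 0 ≤ θ) (hx : 0 ≤ x) (hxy : x ≤ y) :
    Real.log (tiltMass θ x) ≤ Real.log (tiltMass θ y) := by
  refine Real.log_le_log (by linarith [one_le_tiltMass hθ hx]) ?_
  rw [tiltMass, tiltMass]
  nlinarith [Real.one_le_exp hθ]

lemma exp_mul_div_tiltMass_mono {y : ℝ} (hx : 0 ≤ x) (hxy : x ≤ y) (hy : y ≤ 1) :
    Real.exp θ * x / tiltMass θ x ≤ Real.exp θ * y / tiltMass θ y := by
  rw [div_le_div_iff₀ (tiltMass_pos θ ⟨hx, hxy.trans hy⟩) (tiltMass_pos θ ⟨hx.trans hxy, hy⟩),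
    tiltMass, tiltMass]
  nlinarith [Real.exp_pos θ]

lemma exp_mul_div_tiltMass_le {θ' : ℝ} (hθ : θ ≤ θ') (hx : x ∈ Icc (0 : ℝ) 1) :
    Real.exp θ * x / tiltMass θ x ≤ Real.exp θ' * x / tiltMass θ' x := by
  rw [div_le_div_iff₀ (tiltMass_pos θ hx) (tiltMass_pos θ' hx), tiltMass, tiltMass]
  nlinarith [mul_nonneg (sub_nonneg.2 (Real.exp_le_exp.2 hθ)) (mul_nonneg hx.1 (sub_nonneg.2 hx.2))]

end TiltMass

lemma Fbar_mem_Icc (μV : Measure ℝ) [IsProbabilityMeasure μV] (u : ℝ) :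
    Fbar μV u ∈ Icc (0 : ℝ) 1 := ⟨Fbar_nonneg u, Fbar_le_one u⟩

section Drift

variable {lam : ℝ} {μU μV : Measure ℝ} [IsProbabilityMeasure μU] [IsProbabilityMeasure μV]
  {f : ℝ → ℝ} {θ x : ℝ}

lemma ArrivalLaw.deriv_log_tiltMass_pos (hU : ArrivalLaw lam μU) (hθ : 0 ≤ θ) (hx : 0 ≤ x) :
    0 < deriv (psiN μU) (Real.log (tiltMass θ x)) :=
  hU.rate_pos.trans_le (hU.le_deriv_psiN (log_tiltMass_nonneg hθ hx))

/-- A nonnegative tilt only speeds up arrivals and lengthens services. This keeps the scenario from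
falling behind the centre of the band. -/
lemma ArrivalLaw.mul_le_tiltRate (hU : ArrivalLaw lam μU) (hθ : 0 ≤ θ)
    (hx : x ∈ Icc (0 : ℝ) 1) : lam * x ≤ tiltRate μU θ x :=
  mul_le_mul (hU.le_deriv_psiN (log_tiltMass_nonneg hθ hx.1)) (le_exp_mul_div_tiltMass hθ hx)
    hx.1 (hU.deriv_log_tiltMass_pos hθ hx.1).le

lemma ArrivalLaw.tiltRate_nonneg (hU : ArrivalLaw lam μU) (hθ : 0 ≤ θ)
    (hx : x ∈ Icc (0 : ℝ) 1) : 0 ≤ tiltRate μU θ x :=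
  (mul_nonneg hU.rate_pos.le hx.1).trans (hU.mul_le_tiltRate hθ hx)

lemma ArrivalLaw.tiltRate_mono (hU : ArrivalLaw lam μU) {y : ℝ} (hθ : 0 ≤ θ) (hx : 0 ≤ x)
    (hxy : x ≤ y) (hy : y ≤ 1) : tiltRate μU θ x ≤ tiltRate μU θ y :=
  mul_le_mul (hU.deriv_strictMono.monotone (log_tiltMass_mono hθ hx hxy))
    (exp_mul_div_tiltMass_mono hx hxy hy)
    (hx.trans (le_exp_mul_div_tiltMass hθ ⟨hx, hxy.trans hy⟩))
    (hU.deriv_log_tiltMass_pos hθ (hx.trans hxy)).le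

lemma ArrivalLaw.tiltRate_lt (hU : ArrivalLaw lam μU) {θ' : ℝ} (hθ : 0 ≤ θ) (hθ' : θ < θ')
    (hx : x ∈ Icc (0 : ℝ) 1) (hx0 : 0 < x) : tiltRate μU θ x < tiltRate μU θ' x := by
  refine mul_lt_mul (hU.deriv_strictMono ?_) (exp_mul_div_tiltMass_le hθ'.le hx)
    (hx0.trans_le (le_exp_mul_div_tiltMass hθ hx))
    (hU.deriv_log_tiltMass_pos (hθ.trans hθ'.le) hx.1).le
  refine Real.log_lt_log (tiltMass_pos θ hx) ?_
  rw [tiltMass, tiltMass]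
  have := mul_lt_mul_of_pos_right (Real.exp_lt_exp.2 hθ') hx0
  linarith

/-- The bound is linear in `x` and uniform in `θ`, so with `x = Fbar(u)` it is an integrable
majorant for dominated convergence and for differentiation under the integral. -/
lemma ArrivalLaw.exists_abs_tiltRate_le (hU : ArrivalLaw lam μU) (b : ℝ) :
    ∃ M : ℝ, 0 ≤ M ∧ ∀ θ, |θ| ≤ b → ∀ x ∈ Icc (0 : ℝ) 1, |tiltRate μU θ x| ≤ M * x := by
  obtain ⟨D, hD⟩ := (isCompact_Icc (a := -b) (b := b)).exists_bound_of_continuousOn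
    hU.continuous_deriv.continuousOn
  refine ⟨|D| * Real.exp b * Real.exp b, by positivity, fun θ hθ x hx => ?_⟩
  obtain ⟨h1, h2⟩ := abs_log_tiltMass_le hθ hx
  have h3 := (hD _ (abs_le.1 h1)).trans (le_abs_self D)
  rw [Real.norm_eq_abs] at h3
  have hp := tiltMass_pos θ hx
  have h4 : |Real.exp θ * x / tiltMass θ x| ≤ Real.exp b * Real.exp b * x := by
    rw [abs_of_nonneg (div_nonneg (mul_nonneg (Real.exp_pos θ).le hx.1) hp.le), div_le_iff₀ hp]
    have h5 : 1 ≤ Real.exp b * tiltMass θ x := by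
      have := mul_le_mul_of_nonneg_left h2 (Real.exp_pos b).le
      rwa [← Real.exp_add, add_neg_cancel, Real.exp_zero] at this
    have h6 : Real.exp θ * x ≤ Real.exp b * x :=
      mul_le_mul_of_nonneg_right (Real.exp_le_exp.2 (abs_le.1 hθ).2) hx.1
    calc Real.exp θ * x ≤ Real.exp b * x * 1 := by linarith
      _ ≤ Real.exp b * x * (Real.exp b * tiltMass θ x) := by
        gcongr
        exact mul_nonneg (Real.exp_pos b).le hx.1
      _ = _ := by ring
  rw [tiltRate, abs_mul]
  calc _ ≤ |D| * (Real.exp b * Real.exp b * x) := by gcongr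
    _ = _ := by ring

lemma ArrivalLaw.measurable_tiltRate_Fbar (hU : ArrivalLaw lam μU) (θ : ℝ) :
    Measurable fun u => tiltRate μU θ (Fbar μV u) := by
  have h1 := measurable_Fbar (μV := μV)
  have h2 := hU.continuous_deriv.measurable
  have h3 : Measurable fun u => tiltMass θ (Fbar μV u) := by
    unfold tiltMass
    fun_prop
  exact (h2.comp h3.log).mul ((h1.const_mul _).div h3)

lemma integrableOn_tiltRate (hU : ArrivalLaw lam μU) (hV : ServiceLaw μV f) (θ a : ℝ) :
    IntegrableOn (fun u => tiltRate μU θ (Fbar μV u)) (Ioi a) := by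
  obtain ⟨M, _, hM⟩ := hU.exists_abs_tiltRate_le |θ|
  exact ((integrableOn_Fbar hV a).const_mul M).mono'
    (hU.measurable_tiltRate_Fbar θ).aestronglyMeasurable
    (ae_of_all _ fun u => hM θ le_rfl _ (Fbar_mem_Icc μV u))

lemma ArrivalLaw.continuous_tiltRate (hU : ArrivalLaw lam μU) (hx : x ∈ Icc (0 : ℝ) 1) :
    Continuous fun θ => tiltRate μU θ x := by
  have h2 := hU.continuous_deriv
  have h3 : Continuous fun θ => tiltMass θ x := by
    unfold tiltMass
    fun_prop
  have h4 : ∀ θ, tiltMass θ x ≠ 0 := fun θ => (tiltMass_pos θ hx).ne'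
  exact (h2.comp (h3.log h4)).mul ((Real.continuous_exp.mul continuous_const).div h3 h4)

lemma continuous_drift (hU : ArrivalLaw lam μU) (hV : ServiceLaw μV f) :
    Continuous (drift μU μV) := by
  refine continuous_iff_continuousAt.2 fun θ => ?_
  obtain ⟨M, _, hM⟩ := hU.exists_abs_tiltRate_le (|θ| + 1)
  refine continuousAt_of_dominated (bound := fun u => M * Fbar μV u)
    (Eventually.of_forall fun θ => (hU.measurable_tiltRate_Fbar θ).aestronglyMeasurable) ?_
    ((integrableOn_Fbar hV 0).const_mul M)
    (ae_of_all _ fun u => (hU.continuous_tiltRate (Fbar_mem_Icc μV u)).continuousAt)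
  filter_upwards [continuous_abs.continuousAt.eventually_lt continuousAt_const
    (show |θ| < |θ| + 1 by linarith)] with θ' hθ'
  exact ae_of_all _ fun u => hM θ' hθ'.le _ (Fbar_mem_Icc μV u)

lemma ArrivalLaw.hasDerivAt_psiN_log_tiltMass (hU : ArrivalLaw lam μU)
    (hx : x ∈ Icc (0 : ℝ) 1) (θ : ℝ) :
    HasDerivAt (fun θ => psiN μU (Real.log (tiltMass θ x))) (tiltRate μU θ x) θ := by
  have h1 : HasDerivAt (fun θ => tiltMass θ x) (Real.exp θ * x) θ :=
    ((Real.hasDerivAt_exp θ).mul_const x).add_const (1 - x)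
  exact (hU.differentiable _).hasDerivAt.comp θ (h1.log (tiltMass_pos θ hx).ne')

lemma ArrivalLaw.psiN_log_tiltMass_le (hU : ArrivalLaw lam μU) (hθ : 0 ≤ θ)
    (hx : x ∈ Icc (0 : ℝ) 1) :
    psiN μU (Real.log (tiltMass θ x)) ≤ deriv (psiN μU) θ * Real.exp θ * x := by
  refine (hU.psiN_le (log_tiltMass_nonneg hθ hx.1) (log_tiltMass_le hθ hx)).trans ?_
  rw [mul_assoc]
  refine mul_le_mul_of_nonneg_left ?_ (hU.rate_pos.le.trans (hU.le_deriv_psiN hθ))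
  refine (Real.log_le_sub_one_of_pos (tiltMass_pos θ hx)).trans ?_
  rw [tiltMass]
  linarith [hx.1]

lemma ArrivalLaw.measurable_psiN_log_tiltMass (hU : ArrivalLaw lam μU) (θ : ℝ) :
    Measurable fun u => psiN μU (Real.log (tiltMass θ (Fbar μV u))) := by
  have h1 := measurable_Fbar (μV := μV)
  have h2 := hU.differentiable.continuous.measurable
  have h3 : Measurable fun u => tiltMass θ (Fbar μV u) := by
    unfold tiltMass
    fun_prop
  exact h2.comp h3.log

lemma integrableOn_psiN_log_tiltMass (hU : ArrivalLaw lam μU) (hV : ServiceLaw μV f)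
    (hθ : 0 ≤ θ) (a : ℝ) :
    IntegrableOn (fun u => psiN μU (Real.log (tiltMass θ (Fbar μV u)))) (Ioi a) := by
  refine ((integrableOn_Fbar hV a).const_mul (deriv (psiN μU) θ * Real.exp θ)).mono'
    (hU.measurable_psiN_log_tiltMass θ).aestronglyMeasurable (ae_of_all _ fun u => ?_)
  rw [Real.norm_of_nonneg (hU.psiN_nonneg (log_tiltMass_nonneg hθ (Fbar_nonneg u)))]
  exact hU.psiN_log_tiltMass_le hθ (Fbar_mem_Icc μV u)

lemma hasDerivAt_psiInf (hU : ArrivalLaw lam μU) (hV : ServiceLaw μV f) (hθ : 0 ≤ θ) :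
    HasDerivAt (psiInf μU μV) (drift μU μV θ) θ := by
  obtain ⟨M, _, hM⟩ := hU.exists_abs_tiltRate_le (|θ| + 1)
  have h := hasDerivAt_integral_of_dominated_loc_of_deriv_le
    (μ := volume.restrict (Ioi (0 : ℝ))) (x₀ := θ) (s := {y | |y| < |θ| + 1})
    (F := fun θ u => psiN μU (Real.log (tiltMass θ (Fbar μV u))))
    (F' := fun θ u => tiltRate μU θ (Fbar μV u)) (bound := fun u => M * Fbar μV u)
    ((isOpen_lt continuous_abs continuous_const).mem_nhds (show |θ| < |θ| + 1 by linarith))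
    (Eventually.of_forall fun θ => (hU.measurable_psiN_log_tiltMass θ).aestronglyMeasurable)
    (integrableOn_psiN_log_tiltMass hU hV hθ 0)
    (hU.measurable_tiltRate_Fbar θ).aestronglyMeasurable
    (ae_of_all _ fun u y hy => hM y (le_of_lt hy) _ (Fbar_mem_Icc μV u))
    ((integrableOn_Fbar hV 0).const_mul M)
    (ae_of_all _ fun u y _ => hU.hasDerivAt_psiN_log_tiltMass (Fbar_mem_Icc μV u) y)
  rw [show psiInf μU μV = fun n => ∫ u in Ioi (0 : ℝ), psiN μU (Real.log (tiltMass n (Fbar μV u)))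
    from funext (psiInf_eq μU μV)]
  exact h.2

lemma drift_zero (hU : ArrivalLaw lam μU) : drift μU μV 0 = lam * tailInt μV 0 := by
  rw [drift, tailInt, ← integral_const_mul]
  congr 1
  ext u
  simp [tiltRate, tiltMass, hU.deriv_psiN_zero]

lemma drift_lt_drift (hU : ArrivalLaw lam μU) (hV : ServiceLaw μV f) {θ' : ℝ} (hθ : 0 ≤ θ)
    (h : θ < θ') : drift μU μV θ < drift μU μV θ' := by
  have i1 := integrableOn_tiltRate hU hV θ 0
  have i2 := integrableOn_tiltRate hU hV θ' 0
  have hle : ∀ u, tiltRate μU θ (Fbar μV u) ≤ tiltRate μU θ' (Fbar μV u) := by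
    intro u
    rcases (Fbar_nonneg (μV := μV) u).eq_or_lt with h0 | h0
    · rw [← h0]
      simp [tiltRate]
    · exact (hU.tiltRate_lt hθ h (Fbar_mem_Icc μV u) h0).le
  refine lt_of_le_of_ne (integral_mono i1 i2 hle) fun heq => ?_
  have hae := (integral_eq_iff_of_ae_le i1 i2 (ae_of_all _ hle)).1 heq
  obtain ⟨y, hy, hFy⟩ := exists_Fbar_pos hV
  have hnull : volume (Ioo 0 y) = 0 := by
    have h1 := (ae_restrict_iff' measurableSet_Ioi).1 hae
    refine measure_mono_null ?_ (ae_iff.1 h1)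
    intro u hu hne
    exact (hU.tiltRate_lt hθ h (Fbar_mem_Icc μV u)
      (hFy.trans_le (antitone_Fbar hu.2.le))).ne (hne hu.1)
  rw [Real.volume_Ioo, ENNReal.ofReal_eq_zero] at hnull
  linarith

/-- For a fixed `y` with `x = Fbar(y) > 0`, every level `u ≤ y` has tilted rate at least `ψ_N'(θ +
log x) x`, which tends to infinity by steepness. -/
lemma exists_one_lt_drift (hU : ArrivalLaw lam μU) (hV : ServiceLaw μV f) :
    ∃ θ, 0 < θ ∧ 1 < drift μU μV θ := by
  obtain ⟨y, hy, hFy⟩ := exists_Fbar_pos hV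
  set x := Fbar μV y
  have hx : x ∈ Icc (0 : ℝ) 1 := Fbar_mem_Icc μV y
  have hlim : Tendsto (fun θ => deriv (psiN μU) (θ + Real.log x)) atTop atTop :=
    hU.steep.comp (tendsto_atTop_add_const_right _ _ tendsto_id)
  obtain ⟨θ, h1, hθ⟩ := ((hlim.eventually_gt_atTop (1 / (y * x))).and
    (eventually_gt_atTop 0)).exists
  refine ⟨θ, hθ, ?_⟩
  have h2 : deriv (psiN μU) (θ + Real.log x) * x ≤ tiltRate μU θ x := by
    refine mul_le_mul (hU.deriv_strictMono.monotone ?_) (le_exp_mul_div_tiltMass hθ.le hx) hx.1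
      (hU.deriv_log_tiltMass_pos hθ.le hx.1).le
    rw [Real.le_log_iff_exp_le (tiltMass_pos θ hx), Real.exp_add, Real.exp_log hFy, tiltMass]
    linarith [hx.2]
  have h3 : y * tiltRate μU θ x ≤ drift μU μV θ := by
    have i1 := integrableOn_tiltRate hU hV θ 0
    calc y * tiltRate μU θ x = ∫ _ in Ioc 0 y, tiltRate μU θ x := by
          simp [hy.le]
      _ ≤ ∫ u in Ioc 0 y, tiltRate μU θ (Fbar μV u) :=
          setIntegral_mono_on (by simp) (i1.mono_set Ioc_subset_Ioi_self)
            measurableSet_Ioc fun u hu =>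
              hU.tiltRate_mono hθ.le hx.1 (antitone_Fbar hu.2) (Fbar_le_one u)
      _ ≤ drift μU μV θ := setIntegral_mono_set i1
          (ae_of_all _ fun u => hU.tiltRate_nonneg hθ.le (Fbar_mem_Icc μV u))
          Ioc_subset_Ioi_self.eventuallyLE
  have h4 : 1 < y * (deriv (psiN μU) (θ + Real.log x) * x) := by
    rw [div_lt_iff₀ (mul_pos hy hFy)] at h1
    linarith
  nlinarith

lemma isThetaInf_iff (hU : ArrivalLaw lam μU) (hV : ServiceLaw μV f) :
    IsThetaInf μU μV θ ↔ 0 < θ ∧ drift μU μV θ = 1 := by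
  refine and_congr_right fun hθ => ⟨fun h => ?_, fun h => ?_⟩
  · exact (hasDerivAt_psiInf hU hV hθ.le).unique h
  · rw [← h]
    exact hasDerivAt_psiInf hU hV hθ.le

lemma existsUnique_isThetaInf (hU : ArrivalLaw lam μU) (hV : ServiceLaw μV f)
    (hload : lam * ∫ y, y ∂μV < 1) : ∃! θ, IsThetaInf μU μV θ := by
  simp only [isThetaInf_iff hU hV]
  obtain ⟨b, hb, hb1⟩ := exists_one_lt_drift hU hV
  have h0 : drift μU μV 0 < 1 := by
    rwa [drift_zero hU, ← integral_eq_tailInt_zero hV]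
  obtain ⟨θ, hθ, hθ1⟩ := intermediate_value_Icc hb.le (continuous_drift hU hV).continuousOn
    ⟨h0.le, hb1.le⟩
  have hpos : 0 < θ := hθ.1.lt_of_ne (by rintro rfl; exact h0.ne hθ1)
  refine ⟨θ, ⟨hpos, hθ1⟩, fun θ' h => ?_⟩
  rcases lt_trichotomy θ' θ with hl | hl | hl
  · have := drift_lt_drift hU hV h.1.le hl
    linarith [h.2]
  · exact hl
  · have := drift_lt_drift hU hV hpos.le hl
    linarith [h.2]

/-- Slightly above the root the drift exceeds `1` at little additional cost. -/
lemma exists_one_lt_drift_cost_lt (hU : ArrivalLaw lam μU) (hV : ServiceLaw μV f)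
    (hθ : IsThetaInf μU μV θ) {ε : ℝ} (hε : 0 < ε) :
    ∃ t, 0 < t ∧ 1 < drift μU μV t ∧
      t * drift μU μV t - psiInf μU μV t < θ - psiInf μU μV θ + ε := by
  obtain ⟨hθ0, hθ1⟩ := (isThetaInf_iff hU hV).1 hθ
  -- At the root the drift is `1`, so this Legendre cost equals `θ - ψ_∞(θ)` there and stays close
  -- to it just to the right.
  have hc : ContinuousAt (fun t => t * drift μU μV t - psiInf μU μV t) θ :=
    (continuousAt_id.mul (continuous_drift hU hV).continuousAt).sub hθ.2.continuousAt
  have h1 : ∀ᶠ t in 𝓝[>] θ, t * drift μU μV t - psiInf μU μV t < θ - psiInf μU μV θ + ε :=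
    (hc.eventually_lt_const (by simp only [hθ1]; linarith)).filter_mono nhdsWithin_le_nhds
  obtain ⟨t, ht, htθ⟩ := (h1.and self_mem_nhdsWithin).exists
  refine ⟨t, hθ0.trans htθ, ?_, ht⟩
  rw [← hθ1]
  exact drift_lt_drift hU hV hθ0.le htθ

end Drift

/-! ### Blocks of consecutive customers -/

/-- A block of `K s` customers of the `s`-th system is, with probability at least
`exp (-s cost)`, such that its interarrival times add up to between `s lo` and `s hi` and the
service times of at least `s c` of its customers exceed `u`. -/
def BlockBound (μU μV : Measure ℝ) [IsProbabilityMeasure μU] [IsProbabilityMeasure μV]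
    (lo hi u c cost : ℝ) (K : ℕ → ℕ) : Prop :=
  ∀ᶠ s : ℕ in atTop, ∀ a : ℕ, ∃ A B : Set (ℕ → ℝ),
    MeasurableSet[coordSigma (Ico a (a + K s))] A ∧
    MeasurableSet[coordSigma (Ico a (a + K s))] B ∧
    (∀ ω ∈ A, s * lo ≤ ∑ i ∈ Finset.Ico a (a + K s), ω i ∧
      ∑ i ∈ Finset.Ico a (a + K s), ω i ≤ s * hi) ∧
    (∀ ω ∈ B, s * c ≤ (((Finset.Ico a (a + K s)).filter fun i => u < ω i).card : ℝ)) ∧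
    Real.exp (-(s * cost)) ≤ (Measure.infinitePi fun _ : ℕ => μU).real A *
      (Measure.infinitePi fun _ : ℕ => μV).real B

section Blocks

variable {lam : ℝ} {μU μV : Measure ℝ} [IsProbabilityMeasure μU] [IsProbabilityMeasure μV]

lemma integrableExpSet_indicator (u : ℝ) :
    integrableExpSet ((Ioi u).indicator fun _ => (1 : ℝ)) μV = univ := by
  refine eq_univ_of_forall fun t => ?_
  have hm : Measurable ((Ioi u).indicator fun _ => (1 : ℝ)) :=
    measurable_const.indicator measurableSet_Ioi
  refine integrable_exp_mul_of_mem_Icc (a := 0) (b := 1) hm.aemeasurable (ae_of_all _ fun v => ?_)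
  by_cases hv : v ∈ Ioi u <;> simp [hv]

lemma cgf_indicator (u : ℝ) :
    cgf ((Ioi u).indicator fun _ => (1 : ℝ)) μV = fun t => Real.log (tiltMass t (Fbar μV u)) := by
  ext t
  rw [cgf]
  congr 1
  have h : (fun v => Real.exp (t * (Ioi u).indicator (fun _ => (1 : ℝ)) v)) =
      fun v => (Ioi u).indicator (fun _ => Real.exp t - 1) v + 1 := by
    ext v
    by_cases hv : v ∈ Ioi u <;> simp [hv]
  rw [mgf, h, integral_add ((integrable_const _).indicator measurableSet_Ioi) (integrable_const _),
    integral_indicator_const _ measurableSet_Ioi, ← Fbar_eq_measureReal, tiltMass]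
  simp
  ring

lemma deriv_cgf_indicator (u t : ℝ) :
    deriv (cgf ((Ioi u).indicator fun _ => (1 : ℝ)) μV) t =
      Real.exp t * Fbar μV u / tiltMass t (Fbar μV u) := by
  rw [cgf_indicator]
  have h1 : HasDerivAt (fun t => tiltMass t (Fbar μV u)) (Real.exp t * Fbar μV u) t :=
    ((Real.hasDerivAt_exp t).mul_const _).add_const (1 - Fbar μV u)
  exact (h1.log (tiltMass_pos t (Fbar_mem_Icc μV u)).ne').deriv

/-- The block of customers that arrives during a time `h` under the tilt by `θ`. -/
lemma exists_blockBound_tilted (hU : ArrivalLaw lam μU) {θ h ε : ℝ} (hθ : 0 < θ) (hh : 0 < h)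
    (hε : 0 < ε) (u : ℝ) :
    ∃ K : ℕ → ℕ, BlockBound μU μV (h - ε) h u (h * tiltRate μU θ (Fbar μV u) - ε)
      (θ * (h * tiltRate μU θ (Fbar μV u)) -
        h * psiN μU (Real.log (tiltMass θ (Fbar μV u))) + ε) K := by
  set x := Fbar μV u with hxdef
  have hx : x ∈ Icc (0 : ℝ) 1 := Fbar_mem_Icc μV u
  set φ := Real.log (tiltMass θ x) with hφ
  have hφ0 : 0 ≤ φ := log_tiltMass_nonneg hθ.le hx.1
  set n := deriv (psiN μU) φ with hn
  have hn0 : 0 < n := hU.deriv_log_tiltMass_pos hθ.le hx.1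
  set ψ := psiN μU φ
  have hψ0 : 0 ≤ ψ := hU.psiN_nonneg hφ0
  set p := Real.exp θ * x / tiltMass θ x with hp
  have hp0 : 0 ≤ p := hx.1.trans (le_exp_mul_div_tiltMass hθ.le hx)
  have hp1 : p ≤ 1 := by
    rw [hp, div_le_one (tiltMass_pos θ hx), tiltMass]
    linarith [hx.2]
  have hrate : tiltRate μU θ x = n * p := rfl
  rw [hrate]
  have hmean : deriv (cgf id μU) (-ψ) = 1 / n := by
    rw [eq_div_iff hn0.ne']
    exact hU.deriv_cgf_mul_deriv_psiN hφ0
  -- The block has `n (h - ε₁) s` customers rather than `n h s`: fluctuations of size `s ε₁` then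
  -- cannot push the total interarrival time above `s h`. The total is at least `s (h - 2 ε₁)` up to
  -- rounding.
  obtain ⟨ε₁, hε₁, h1, h2, h3, h4⟩ : ∃ ε₁ : ℝ, 0 < ε₁ ∧ ε₁ ≤ ε / 4 ∧ ε₁ < h ∧
      2 * ε₁ * ψ ≤ ε / 4 ∧ n * ε₁ ≤ ε / 4 := by
    refine ⟨min (min (ε / 4) (h / 2)) (min (ε / (8 * (ψ + 1))) (ε / (4 * n))), by positivity,
      (min_le_left _ _).trans (min_le_left _ _), ?_, ?_, ?_⟩
    · exact ((min_le_left _ _).trans (min_le_right _ _)).trans_lt (by linarith)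
    · have := (min_le_right (min (ε / 4) (h / 2)) (min (ε / (8 * (ψ + 1))) (ε / (4 * n)))).trans
        (min_le_left _ _)
      rw [le_div_iff₀ (by positivity)] at this
      nlinarith [show 0 < min (min (ε / 4) (h / 2)) (min (ε / (8 * (ψ + 1))) (ε / (4 * n))) by
        positivity]
    · have := (min_le_right (min (ε / 4) (h / 2)) (min (ε / (8 * (ψ + 1))) (ε / (4 * n)))).trans
        (min_le_right _ _)
      rw [le_div_iff₀ (by positivity)] at this
      linarith
  obtain ⟨ε₂, hε₂, h5⟩ : ∃ ε₂ : ℝ, 0 < ε₂ ∧ n * h * ε₂ = ε₁ :=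
    ⟨ε₁ / (n * h), by positivity, by field_simp⟩
  obtain ⟨ε₃, hε₃, h6, h7⟩ : ∃ ε₃ : ℝ, 0 < ε₃ ∧ n * h * θ * ε₃ ≤ ε / 4 ∧ n * h * ε₃ ≤ ε / 4 := by
    have e : n * h * (θ + 1) * (ε / (4 * n * h * (θ + 1))) = ε / 4 := by field_simp
    have hpos : 0 < ε / (4 * n * h * (θ + 1)) := by positivity
    refine ⟨ε / (4 * n * h * (θ + 1)), hpos, ?_, ?_⟩
    · nlinarith [mul_pos (mul_pos hn0 hh) hpos]
    · nlinarith [mul_pos (mul_pos (mul_pos hn0 hh) hθ) hpos]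
  refine ⟨fun s => ⌊s * (n * (h - ε₁))⌋₊, ?_⟩
  have hslope : 0 < n * (h - ε₁) := mul_pos hn0 (by linarith)
  have hKlim : Tendsto (fun s : ℕ => ⌊(s : ℝ) * (n * (h - ε₁))⌋₊) atTop atTop :=
    tendsto_nat_floor_atTop.comp (tendsto_natCast_atTop_atTop.atTop_mul_const hslope)
  have hg : Measurable ((Ioi u).indicator fun _ => (1 : ℝ)) :=
    measurable_const.indicator measurableSet_Ioi
  have eU := hKlim.eventually (eventually_le_measureReal_block (μ := μU) measurable_id
    (hU.mem_interior (neg_nonpos.2 hψ0)) hε₂)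
  have eV := hKlim.eventually (eventually_le_measureReal_block (μ := μV) hg
    (t := θ) (by rw [integrableExpSet_indicator, interior_univ]; trivial) hε₃)
  -- Absorbs the rounding of the block length and the two factors `1/2` of the Cramér bounds.
  have es : ∀ᶠ s : ℕ in atTop, (1 / n + ψ / n + 1 + Real.log 4) / (ε / 4) ≤ (s : ℝ) :=
    tendsto_natCast_atTop_atTop.eventually_ge_atTop _
  filter_upwards [eU, eV, es] with s hsU hsV hs a
  rw [div_le_iff₀ (by positivity)] at hs
  have hlog4 : 0 < Real.log 4 := Real.log_pos (by norm_num)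
  have hs0 : (0 : ℝ) ≤ s := Nat.cast_nonneg s
  have i1 : 0 < 1 / n := by positivity
  have i2 : 0 ≤ ψ / n := by positivity
  set k := ⌊(s : ℝ) * (n * (h - ε₁))⌋₊ with hk
  have hk1 : (k : ℝ) ≤ s * (n * (h - ε₁)) := Nat.floor_le (by positivity)
  have hk2 : s * (n * (h - ε₁)) - 1 ≤ k := (Nat.sub_one_lt_floor _).le
  have hk3 : (k : ℝ) ≤ s * (n * h) := hk1.trans (by gcongr; linarith)
  have hk0 : (0 : ℝ) ≤ k := Nat.cast_nonneg k
  have hinv : n * (1 / n) = 1 := by field_simp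
  have hkn1 : k * (1 / n) ≤ s * (h - ε₁) := by
    calc k * (1 / n) ≤ s * (n * (h - ε₁)) * (1 / n) := by gcongr
      _ = s * (h - ε₁) * (n * (1 / n)) := by ring
      _ = s * (h - ε₁) := by rw [hinv, mul_one]
  have hkn2 : s * (h - ε₁) - 1 / n ≤ k * (1 / n) := by
    calc s * (h - ε₁) - 1 / n = (s * (h - ε₁)) * (n * (1 / n)) - 1 / n := by rw [hinv, mul_one]
      _ = (s * (n * (h - ε₁)) - 1) * (1 / n) := by ring
      _ ≤ k * (1 / n) := by gcongr
  have hkε₂ : k * ε₂ ≤ s * ε₁ := by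
    calc k * ε₂ ≤ s * (n * h) * ε₂ := by gcongr
      _ = s * ε₁ := by rw [← h5]; ring
  have hkε₃ : k * ε₃ ≤ s * (ε / 4) := by
    calc k * ε₃ ≤ s * (n * h) * ε₃ := by gcongr
      _ = s * (n * h * ε₃) := by ring
      _ ≤ s * (ε / 4) := by gcongr
  have hsε₁ : s * ε₁ ≤ s * (ε / 4) := by gcongr
  -- The sets are left to unification: they are the events appearing in `hsU a` and `hsV a`.
  refine ⟨_, _, ?_, ?_, ?_, ?_, (?_ : Real.exp (-(s * (θ * (h * (n * p)) - h * ψ + ε))) ≤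
    _ * _).trans (mul_le_mul (hsU a) (hsV a) (by positivity) measureReal_nonneg)⟩
  · have hS : Measurable[coordSigma (Ico a (a + k))]
        fun ω : ℕ → ℝ => ∑ i ∈ Finset.Ico a (a + k), id (ω i) :=
      Finset.measurable_sum _ fun i hi => measurable_coord (by simpa using hi)
    exact hS measurableSet_Ioo
  · have hS : Measurable[coordSigma (Ico a (a + k))] fun ω : ℕ → ℝ =>
        ∑ i ∈ Finset.Ico a (a + k), (Ioi u).indicator (fun _ => (1 : ℝ)) (ω i) :=
      Finset.measurable_sum _ fun i hi => hg.comp (measurable_coord (by simpa using hi))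
    exact hS measurableSet_Ioo
  · rintro ω ⟨hω1, hω2⟩
    rw [hmean] at hω1 hω2
    simp only [id] at hω1 hω2
    constructor
    · linarith
    · linarith
  · rintro ω ⟨hω1, -⟩
    rw [deriv_cgf_indicator, ← hxdef, ← hp] at hω1
    have hcount : ∑ i ∈ Finset.Ico a (a + k), (Ioi u).indicator (fun _ => (1 : ℝ)) (ω i) =
        (((Finset.Ico a (a + k)).filter fun i => u < ω i).card : ℝ) := by
      rw [Finset.card_filter]
      push_cast
      rfl
    rw [hcount] at hω1
    have hkp : s * (h * (n * p)) - s * (ε / 4) - 1 ≤ k * p := by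
      have e1 := mul_le_mul_of_nonneg_right hk2 hp0
      have e2 : s * (n * ε₁) * p ≤ s * (ε / 4) * 1 := by gcongr
      linarith
    linarith
  -- Per customer the arrivals cost `φ - ψ / n` and the services `θ p - φ`. The terms `φ` cancel,
  -- and about `n h s` customers cost `s h (θ n p - ψ)`.
  · rw [hmean, hU.cgf_neg_psiN, deriv_cgf_indicator, cgf_indicator, ← hxdef, ← hp,
      abs_neg, abs_of_nonneg hψ0, abs_of_pos hθ]
    have hquarter : (1 : ℝ) / 4 = Real.exp (-Real.log 4) := by
      rw [Real.exp_neg, Real.exp_log (by norm_num)]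
      norm_num
    have hcomb : ∀ y z : ℝ, Real.exp y / 2 * (Real.exp z / 2) = Real.exp (y + z - Real.log 4) := by
      intro y z
      rw [sub_eq_add_neg, Real.exp_add, Real.exp_add, ← hquarter]
      ring
    rw [hcomb]
    apply Real.exp_le_exp.2
    have j1 : s * (h - ε₁) * ψ - ψ / n ≤ k * (1 / n) * ψ := by
      calc s * (h - ε₁) * ψ - ψ / n = (s * (h - ε₁) - 1 / n) * ψ := by ring
        _ ≤ _ := by gcongr
    have j2 : k * (θ * p) ≤ s * (θ * (h * (n * p))) := by
      calc k * (θ * p) ≤ s * (n * h) * (θ * p) := by gcongr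
        _ = _ := by ring
    have j3 : k * (ψ * ε₂) ≤ s * (ε₁ * ψ) := by
      calc k * (ψ * ε₂) = k * ε₂ * ψ := by ring
        _ ≤ s * ε₁ * ψ := by gcongr
        _ = _ := by ring
    have j4 : k * (θ * ε₃) ≤ s * (ε / 4) := by
      calc k * (θ * ε₃) ≤ s * (n * h) * (θ * ε₃) := by gcongr
        _ = s * (n * h * θ * ε₃) := by ring
        _ ≤ _ := by gcongr
    have j5 : s * (2 * ε₁ * ψ) ≤ s * (ε / 4) := by gcongr
    linarith

lemma measurableSet_forall_mem_coordSigma {S : Finset ℕ} {t : Set ℝ} (ht : MeasurableSet t) :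
    MeasurableSet[coordSigma S] {ω : ℕ → ℝ | ∀ i ∈ S, ω i ∈ t} := by
  have : {ω : ℕ → ℝ | ∀ i ∈ S, ω i ∈ t} = ⋂ i ∈ S, (fun ω : ℕ → ℝ => ω i) ⁻¹' t := by
    ext ω
    simp
  rw [this]
  exact Finset.measurableSet_biInter _ fun i hi => measurable_coord (Finset.mem_coe.2 hi) ht

lemma measureReal_forall_mem {μ : Measure ℝ} [IsProbabilityMeasure μ] (S : Finset ℕ) {t : Set ℝ}
    (ht : MeasurableSet t) :
    (Measure.infinitePi fun _ : ℕ => μ).real {ω : ℕ → ℝ | ∀ i ∈ S, ω i ∈ t} =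
      μ.real t ^ S.card := by
  have h := Measure.infinitePi_pi (fun _ : ℕ => μ) (s := S) (t := fun _ => t) fun _ _ => ht
  have e : {ω : ℕ → ℝ | ∀ i ∈ S, ω i ∈ t} = Set.pi S fun _ => t := by
    ext ω
    simp [Set.mem_pi]
  rw [measureReal_def, e, h, measureReal_def, Finset.prod_const, ENNReal.toReal_pow]

/-- A block of about `κ s` customers that all arrive within the time `δ` and whose service times
all exceed `u`. -/
lemma exists_blockBound_ramp {κ δ u : ℝ} (hκ : 0 < κ) (hδ : 0 < δ)
    (hq : 1 / 2 ≤ μU.real (Icc 0 (δ / (2 * κ)))) (hu : 0 < Fbar μV u) :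
    ∃ K : ℕ → ℕ, BlockBound μU μV 0 δ u κ (2 * κ * (Real.log 2 - Real.log (Fbar μV u))) K ∧
      ∀ᶠ s : ℕ in atTop, (K s : ℝ) ≤ s * (2 * κ) := by
  have hK : ∀ᶠ s : ℕ in atTop, ((⌈s * κ⌉₊ : ℕ) : ℝ) ≤ s * (2 * κ) := by
    filter_upwards [tendsto_natCast_atTop_atTop.eventually_ge_atTop (1 / κ)] with s hs
    rw [div_le_iff₀ hκ] at hs
    have := Nat.ceil_lt_add_one (mul_nonneg (Nat.cast_nonneg (α := ℝ) s) hκ.le)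
    linarith
  refine ⟨fun s => ⌈s * κ⌉₊, ?_, hK⟩
  filter_upwards [hK] with s hs a
  set k := ⌈(s : ℝ) * κ⌉₊
  have hk : s * κ ≤ k := Nat.le_ceil _
  refine ⟨{ω | ∀ i ∈ Finset.Ico a (a + k), ω i ∈ Icc 0 (δ / (2 * κ))},
    {ω | ∀ i ∈ Finset.Ico a (a + k), ω i ∈ Ioi u}, ?_, ?_, ?_, ?_, ?_⟩
  · have := measurableSet_forall_mem_coordSigma (S := Finset.Ico a (a + k))
      (measurableSet_Icc (a := (0 : ℝ)) (b := δ / (2 * κ)))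
    rwa [Finset.coe_Ico] at this
  · have := measurableSet_forall_mem_coordSigma (S := Finset.Ico a (a + k))
      (measurableSet_Ioi (a := u))
    rwa [Finset.coe_Ico] at this
  · intro ω hω
    constructor
    · rw [mul_zero]
      exact Finset.sum_nonneg fun i hi => (hω i hi).1
    · refine (Finset.sum_le_card_nsmul _ _ _ fun i hi => (hω i hi).2).trans ?_
      rw [Nat.card_Ico, add_tsub_cancel_left, nsmul_eq_mul]
      calc k * (δ / (2 * κ)) ≤ s * (2 * κ) * (δ / (2 * κ)) := by gcongr
        _ = s * δ := by field_simp
  · intro ω hω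
    rw [Finset.filter_true_of_mem (p := fun i => u < ω i) fun i hi => hω i hi, Nat.card_Ico, add_tsub_cancel_left]
    exact hk
  · rw [measureReal_forall_mem _ measurableSet_Icc, measureReal_forall_mem _ measurableSet_Ioi,
      Nat.card_Ico, add_tsub_cancel_left, ← mul_pow, ← Fbar_eq_measureReal]
    -- A crude bound per customer suffices, since the number of ramp customers will be a small
    -- multiple of `s`.
    have h1 : 1 / 2 * Fbar μV u ≤ μU.real (Icc 0 (δ / (2 * κ))) * Fbar μV u :=
      mul_le_mul_of_nonneg_right hq hu.le
    refine le_trans ?_ (pow_le_pow_left₀ (by positivity) h1 k)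
    have h2 : 1 / 2 * Fbar μV u = Real.exp (-(Real.log 2 - Real.log (Fbar μV u))) := by
      rw [neg_sub, Real.exp_sub, Real.exp_log hu, Real.exp_log (by norm_num)]
      ring
    rw [h2, ← Real.exp_nat_mul]
    apply Real.exp_le_exp.2
    have h3 : 0 ≤ Real.log 2 - Real.log (Fbar μV u) := by
      have := Real.log_nonpos hu.le (Fbar_le_one u)
      have := Real.log_pos one_lt_two
      linarith
    have := mul_le_mul_of_nonneg_right hs h3
    linarith

end Blocks

/-! ### Pathwise comparison of the overflow time with the return time -/

section Pathwise

variable {s : ℕ} {r : ℝ → ℕ} {ω : Path}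

/-- Excluding the inspections up to `x` gives strict inequality even for an infimum, because the
first grid point beyond `x` is a lower bound. -/
lemma lt_returnTime {lam C η γ : ℝ} {μV : Measure ℝ} {Δ : ℝ} (hΔ : 0 < Δ) {q : ℝ → ℝ → ℕ} {x : ℝ}
    (h : ∀ k : ℕ, 1 ≤ k → k * Δ ≤ x → ¬ InBand lam C η γ μV s (q (k * Δ))) :
    (x : EReal) < returnTime lam C η γ μV Δ s q := by
  have hx : x < ((⌊x / Δ⌋₊ + 1 : ℕ) : ℝ) * Δ := by
    rw [← div_lt_iff₀ hΔ]
    exact_mod_cast Nat.lt_floor_add_one (x / Δ)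
  refine (EReal.coe_lt_coe_iff.2 hx).trans_le (le_sInf ?_)
  rintro _ ⟨k, ⟨hk, hb⟩, rfl⟩
  have hxk : x < k * Δ := not_le.1 fun hle => h k hk hle hb
  have hfl : ⌊x / Δ⌋₊ < k := (Nat.floor_lt' (by omega)).2 ((div_lt_iff₀ hΔ).2 hxk)
  have : ((⌊x / Δ⌋₊ + 1 : ℕ) : ℝ) ≤ k := by exact_mod_cast hfl
  exact EReal.coe_le_coe_iff.2 (mul_le_mul_of_nonneg_right this hΔ.le)

lemma mem_admitted {n j : ℕ} : j ∈ admitted s r ω n ↔ j < n ∧ IsServed s r ω j := by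
  induction n with
  | zero => simp [admitted]
  | succ n ih =>
    have hn : j = n → (j ∈ admitted s r ω (n + 1) ↔ IsServed s r ω j) := by
      rintro rfl
      rfl
    rcases eq_or_ne j n with h | h
    · rw [hn h]
      simp [h]
    · have : j ∈ admitted s r ω (n + 1) ↔ j ∈ admitted s r ω n := by
        rw [admitted]
        split_ifs <;> simp [h]
      rw [this, ih]
      exact and_congr_left fun _ => by omega

open Classical in
lemma isServed_iff {n : ℕ} : IsServed s r ω n ↔ r (arrival s ω n) +
    ((admitted s r ω n).filter fun j => arrival s ω n < completion s ω j).card < s := by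
  have hn : n ∉ admitted s r ω n := fun h => lt_irrefl n (mem_admitted.1 h).1
  rw [IsServed, admitted]
  split_ifs with h <;> simp [h, hn]

/-- If the profile is out of the band up to the time `E`, and if at that time more than `s`
customers are present in the infinite server system, then overflow precedes the return. -/
lemma overflowTime_lt_returnTime {lam C η γ : ℝ} {μV : Measure ℝ} {Δ τ E : ℝ} (hΔ : 0 < Δ)
    (hE : 0 < E) (hfin : ∀ t, {i | arrival s ω i ≤ t}.Finite)
    (hlow : ∀ k : ℕ, 1 ≤ k → k * Δ < τ → ∀ N : ℕ,
      N ≤ r (k * Δ) + {i | arrival s ω i ≤ k * Δ}.ncard → (N : ℝ) ∉ band lam C η γ μV s 0)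
    (hhigh : ∀ t, τ ≤ t → t ≤ E → ∀ N : ℕ,
      {i | arrival s ω i ≤ t ∧ E < completion s ω i}.ncard ≤ N →
      (N : ℝ) ∉ band lam C η γ μV s (E - t))
    (hover : s < {i | arrival s ω i ≤ E ∧ E < completion s ω i}.ncard) :
    overflowTime s r ω < returnTime lam C η γ μV Δ s (QInf s r ω) := by
  have h1 : overflowTime s r ω ≤ E := by
    refine sInf_le ⟨E, ⟨hE, hover.trans_le ?_⟩, rfl⟩
    rw [QInf]
    simp only [sub_pos]
    exact Nat.le_add_left _ _
  refine h1.trans_lt (lt_returnTime hΔ fun k hk hkE hb => ?_)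
  rcases lt_or_ge (k * Δ) τ with h | h
  · refine hlow k hk h _ ?_ (hb 0 le_rfl)
    rw [QInf, add_zero]
    exact Nat.add_le_add_left (Set.ncard_le_ncard (fun i hi => hi.1) (hfin _)) _
  -- At level `y = E - t` the residual service exceeds `y` exactly when the customer is still
  -- present at the fixed time `E`.
  · refine hhigh _ h hkE _ ?_ (hb (E - k * Δ) (sub_nonneg.2 hkE))
    rw [QInf]
    simp only [sub_lt_sub_iff_right]
    exact Nat.le_add_left _ _

/-- The analogue of `overflowTime_lt_returnTime` for the loss system. -/
lemma firstLossTime_lt_returnTime {lam C η γ : ℝ} {μV : Measure ℝ} {Δ τ E : ℝ} (hΔ : 0 < Δ)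
    (hmono : Monotone (arrival s ω)) (hfin : ∀ t, {i | arrival s ω i ≤ t}.Finite)
    (hlow : ∀ k : ℕ, 1 ≤ k → k * Δ < τ → ∀ N : ℕ,
      N ≤ r (k * Δ) + {i | arrival s ω i ≤ k * Δ}.ncard → (N : ℝ) ∉ band lam C η γ μV s 0)
    (hhigh : ∀ t, τ ≤ t → t ≤ E → ∀ N : ℕ,
      {i | arrival s ω i ≤ t ∧ E < completion s ω i}.ncard ≤ N →
      (N : ℝ) ∉ band lam C η γ μV s (E - t))
    (hover : s < {i | arrival s ω i ≤ E ∧ E < completion s ω i}.ncard)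
    (hfull : ∀ N : ℕ, s ≤ N → (N : ℝ) ∉ band lam C η γ μV s 0) :
    firstLossTime s r ω < returnTime lam C η γ μV Δ s (QLoss s r ω) := by
  classical
  have hlost : ∃ i, ¬ IsServed s r ω i ∧ arrival s ω i ≤ E := by
    by_contra! hall
    have hserved : ∀ i, arrival s ω i ≤ E → IsServed s r ω i := fun i hi => by
      by_contra h
      exact absurd hi (not_le.2 (hall i h))
    set F := (hfin E).toFinset with hF
    have hne : F.Nonempty := by
      rw [Finset.nonempty_iff_ne_empty]
      intro h0
      have hempty : {i | arrival s ω i ≤ E ∧ E < completion s ω i} = ∅ := by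
        refine Set.eq_empty_of_forall_notMem fun i hi => ?_
        have : i ∈ F := (hfin E).mem_toFinset.2 hi.1
        simp [h0] at this
      rw [hempty, Set.ncard_empty] at hover
      omega
    -- If nobody arriving by `E` were lost, the last of them would have met fewer than `s`
    -- customers. All survivors at `E` are that customer or among those it met, so there could not
    -- be more than `s`.
    set n := F.max' hne
    have hnE : arrival s ω n ≤ E := (hfin E).mem_toFinset.1 (F.max'_mem hne)
    have hn := isServed_iff.1 (hserved n hnE)
    have hsub : {i | arrival s ω i ≤ E ∧ E < completion s ω i} ⊆
        (insert n ((admitted s r ω n).filter fun j => arrival s ω n < completion s ω j) :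
          Finset ℕ) := by
      intro i hi
      have hin : i ≤ n := F.le_max' i ((hfin E).mem_toFinset.2 hi.1)
      rw [Finset.mem_coe, Finset.mem_insert, Finset.mem_filter, mem_admitted]
      rcases hin.eq_or_lt with h | h
      · exact Or.inl h
      · exact Or.inr ⟨⟨h, hserved i hi.1⟩, hnE.trans_lt hi.2⟩
    have hcard := Set.ncard_le_ncard hsub (Finset.finite_toSet _)
    rw [Set.ncard_coe_finset] at hcard
    have := Finset.card_insert_le n
      ((admitted s r ω n).filter fun j => arrival s ω n < completion s ω j)
    omega
  obtain ⟨i₀, hi₀, hi₀E⟩ := hlost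
  have hex : ∃ i, ¬ IsServed s r ω i := ⟨i₀, hi₀⟩
  set n := Nat.find hex
  have hn : ¬ IsServed s r ω n := Nat.find_spec hex
  have hbefore : ∀ i < n, IsServed s r ω i := fun i hi => not_not.1 (Nat.find_min hex hi)
  have hnE : arrival s ω n ≤ E := (hmono (Nat.find_min' hex hi₀)).trans hi₀E
  have h1 : firstLossTime s r ω ≤ arrival s ω n := sInf_le ⟨n, hn, rfl⟩
  refine h1.trans_lt (lt_returnTime hΔ fun k hk hkn hb => ?_)
  rcases lt_or_ge (k * Δ) τ with h | h
  · refine hlow k hk h _ ?_ (hb 0 le_rfl)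
    rw [QLoss, add_zero]
    exact Nat.add_le_add_left (Set.ncard_le_ncard (fun i hi => hi.1) (hfin _)) _
  -- Strictly before the first lost customer, all arrivals so far are served, so `hhigh` applies. If
  -- inspection coincides with its arrival, all `s` servers are busy, and `hfull` places the profile
  -- outside the band.
  rcases hkn.lt_or_eq with hlt | heq
  · refine hhigh _ h (hkn.trans hnE) _ ?_ (hb (E - k * Δ) (sub_nonneg.2 (hkn.trans hnE)))
    rw [QLoss]
    simp only [sub_lt_sub_iff_right]
    refine le_trans (Set.ncard_le_ncard ?_ ((hfin (k * Δ)).subset fun i hi => hi.1))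
      (Nat.le_add_left _ _)
    intro i hi
    refine ⟨hi.1, hbefore i ?_, hi.2⟩
    by_contra! hni
    exact absurd (hmono hni) (not_le.2 (hi.1.trans_lt hlt))
  · refine hfull _ ?_ (hb 0 le_rfl)
    rw [isServed_iff, not_lt] at hn
    refine hn.trans ?_
    rw [QLoss, add_zero, heq]
    refine Nat.add_le_add_left ?_ _
    rw [← Set.ncard_coe_finset]
    refine Set.ncard_le_ncard ?_ ((hfin (arrival s ω n)).subset fun i hi => hi.1)
    intro i hi
    rw [Finset.mem_coe, Finset.mem_filter, mem_admitted] at hi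
    exact ⟨hmono hi.1.1.le, hi.1.2, sub_pos.2 hi.2⟩

lemma arrival_sub_arrival {a b : ℕ} (hab : a ≤ b) :
    arrival s ω b - arrival s ω a = (∑ i ∈ Finset.Ico a b, ω.2.1 i) / s := by
  rw [arrival, arrival, Finset.sum_Ico_eq_sub _ hab]
  ring

lemma monotone_arrival (hω : ∀ i, 0 ≤ ω.2.1 i) : Monotone (arrival s ω) := fun a b hab => by
  have := arrival_sub_arrival (s := s) (ω := ω) hab
  have : 0 ≤ (∑ i ∈ Finset.Ico a b, ω.2.1 i) / s :=
    div_nonneg (Finset.sum_nonneg fun i _ => hω i) (Nat.cast_nonneg s)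
  linarith

/-- Customers of consecutive blocks, arriving at the prescribed speed and with sufficiently long
service times, are still present at the time `arrival (a 1) + T`. -/
lemma mul_sum_le_ncard_survivors (hs : 0 < s) (hmono : Monotone (arrival s ω))
    (hfin : ∀ t, {i | arrival s ω i ≤ t}.Finite) {a : ℕ → ℕ} (ha : Monotone a)
    {m : ℕ} {h ε δ T : ℝ} {c u : ℕ → ℝ} (hε : 0 ≤ ε) (hm : m * ε ≤ h)
    (hramp : ∑ i ∈ Finset.Ico (a 0) (a 1), ω.2.1 i ≤ s * δ)
    (hlo : ∀ j, 1 ≤ j → j ≤ m → s * (h - ε) ≤ ∑ i ∈ Finset.Ico (a j) (a (j + 1)), ω.2.1 i)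
    (hhi : ∀ j, 1 ≤ j → j ≤ m → ∑ i ∈ Finset.Ico (a j) (a (j + 1)), ω.2.1 i ≤ s * h)
    (hcount : ∀ j ≤ m,
      s * c j ≤ (((Finset.Ico (a j) (a (j + 1))).filter fun i => u j < ω.2.2 i).card : ℝ))
    (hu0 : T + δ ≤ u 0) (hu : ∀ j, 1 ≤ j → j ≤ m → T - (j - 2) * h ≤ u j)
    {j : ℕ} (hj : j ≤ m) {t : ℝ} (ht : arrival s ω (a 1) + j * h ≤ t) :
    s * ∑ l ∈ Finset.range (j + 1), c l ≤
      ({i | arrival s ω i ≤ t ∧ arrival s ω (a 1) + T < completion s ω i}.ncard : ℝ) := by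
  have hs' : (0 : ℝ) < s := Nat.cast_pos.2 hs
  set τ := arrival s ω (a 1)
  have hup : ∀ j ≤ m, arrival s ω (a (j + 1)) ≤ τ + j * h := by
    intro j
    induction j with
    | zero => simp [τ]
    | succ j ih =>
      intro hj
      have h1 := ih (by omega)
      have h2 := arrival_sub_arrival (s := s) (ω := ω) (ha (Nat.le_succ (j + 1)))
      have h3 := (div_le_iff₀' hs').2 (hhi (j + 1) (by omega) hj)
      push_cast
      linarith
  have hdn : ∀ j ≤ m, τ + j * (h - ε) ≤ arrival s ω (a (j + 1)) := by
    intro j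
    induction j with
    | zero => simp [τ]
    | succ j ih =>
      intro hj
      have h1 := ih (by omega)
      have h2 := arrival_sub_arrival (s := s) (ω := ω) (ha (Nat.le_succ (j + 1)))
      have h3 := (le_div_iff₀' hs').2 (hlo (j + 1) (by omega) hj)
      push_cast
      linarith
  have hsurv : ∀ j ≤ m, ∀ i ∈ Finset.Ico (a j) (a (j + 1)), u j < ω.2.2 i →
      τ + T < completion s ω i := by
    intro j hj i hi hui
    rw [Finset.mem_Ico] at hi
    rw [completion]
    rcases j with _ | j
    -- Ramp customers arrive no earlier than `τ - δ`, which explains the requirement `T + δ ≤ u 0`.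
    · have h1 := arrival_sub_arrival (s := s) (ω := ω) (ha (Nat.le_succ 0))
      have h2 := (div_le_iff₀' hs').2 hramp
      have h3 := hmono hi.1
      have h4 : τ = arrival s ω (a (Nat.succ 0)) := rfl
      linarith
    -- Block `j + 1` starts no earlier than `τ + j (h - ε) ≥ τ + (j - 1) h`: the accumulated slack
    -- costs at most one extra `h` of service time.
    · have h1 := hdn j (by omega)
      have h2 := hmono hi.1
      have h3 := hu (j + 1) (by omega) hj
      push_cast at h3
      have h4 : (j : ℝ) * ε ≤ m * ε := by
        gcongr
        omega
      linarith
  have hsum : ∀ j ≤ m, s * ∑ l ∈ Finset.range (j + 1), c l ≤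
      (((Finset.range (a (j + 1))).filter fun i => τ + T < completion s ω i).card : ℝ) := by
    have hstep : ∀ j ≤ m, ∀ x : ℝ,
        x ≤ (((Finset.range (a j)).filter fun i => τ + T < completion s ω i).card : ℝ) →
        x + s * c j ≤
          (((Finset.range (a (j + 1))).filter fun i => τ + T < completion s ω i).card : ℝ) := by
      intro j hj x hx
      have h1 := hcount j hj
      have h2 : ((Finset.range (a j)).filter fun i => τ + T < completion s ω i).card +
          ((Finset.Ico (a j) (a (j + 1))).filter fun i => u j < ω.2.2 i).card ≤
          ((Finset.range (a (j + 1))).filter fun i => τ + T < completion s ω i).card := by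
        rw [← Finset.card_union_of_disjoint]
        · refine Finset.card_le_card ?_
          intro i hi
          rw [Finset.mem_union, Finset.mem_filter, Finset.mem_filter] at hi
          rw [Finset.mem_filter, Finset.mem_range]
          rcases hi with hi | hi
          · exact ⟨(Finset.mem_range.1 hi.1).trans_le (ha (Nat.le_succ j)), hi.2⟩
          · exact ⟨(Finset.mem_Ico.1 hi.1).2, hsurv j hj i hi.1 hi.2⟩
        · rw [Finset.disjoint_left]
          intro i hi hi'
          have h3 := Finset.mem_range.1 (Finset.mem_filter.1 hi).1
          have h4 := (Finset.mem_Ico.1 (Finset.mem_filter.1 hi').1).1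
          omega
      have h3 : (((Finset.range (a j)).filter fun i => τ + T < completion s ω i).card : ℝ) +
          ((Finset.Ico (a j) (a (j + 1))).filter fun i => u j < ω.2.2 i).card ≤
          ((Finset.range (a (j + 1))).filter fun i => τ + T < completion s ω i).card := by
        exact_mod_cast h2
      linarith
    intro j
    induction j with
    | zero =>
      intro hj
      have := hstep 0 hj 0 (Nat.cast_nonneg _)
      simpa using this
    | succ j ih =>
      intro hj
      rw [Finset.sum_range_succ, mul_add]
      exact hstep (j + 1) hj _ (ih (by omega))
  refine (hsum j hj).trans ?_
  rw [← Set.ncard_coe_finset]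
  have hle : ((Finset.range (a (j + 1))).filter fun i => τ + T < completion s ω i : Set ℕ).ncard ≤
      {i | arrival s ω i ≤ t ∧ τ + T < completion s ω i}.ncard := by
    refine Set.ncard_le_ncard ?_ ((hfin t).subset fun i hi => hi.1)
    intro i hi
    rw [Finset.mem_coe, Finset.mem_filter, Finset.mem_range] at hi
    exact ⟨(hmono hi.1.le).trans ((hup j hj).trans ht), hi.2⟩
  exact_mod_cast hle

end Pathwise

/-! ### Families of blocks -/

section Family

variable {lam : ℝ} {μU μV : Measure ℝ} [IsProbabilityMeasure μU] [IsProbabilityMeasure μV]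
  {f : ℝ → ℝ}

lemma eventually_exists_sets_of_blockBound {n : ℕ} {lo hi u c cost : ℕ → ℝ} {K : ℕ → ℕ → ℕ}
    (h : ∀ j < n, BlockBound μU μV (lo j) (hi j) (u j) (c j) (cost j) (K j)) :
    ∀ᶠ s : ℕ in atTop, ∀ a : ℕ → ℕ, (∀ j, a (j + 1) = a j + K j s) →
      ∃ A B : Set (ℕ → ℝ), MeasurableSet A ∧ MeasurableSet B ∧
        (∀ ω ∈ A, ∀ j < n, s * lo j ≤ ∑ i ∈ Finset.Ico (a j) (a (j + 1)), ω i ∧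
          ∑ i ∈ Finset.Ico (a j) (a (j + 1)), ω i ≤ s * hi j) ∧
        (∀ ω ∈ B, ∀ j < n, s * c j ≤
          (((Finset.Ico (a j) (a (j + 1))).filter fun i => u j < ω i).card : ℝ)) ∧
        Real.exp (-(s * ∑ j ∈ Finset.range n, cost j)) ≤
          (Measure.infinitePi fun _ : ℕ => μU).real A *
            (Measure.infinitePi fun _ : ℕ => μV).real B := by
  filter_upwards [(eventually_all_finite (Set.finite_lt_nat n)).2 h] with s hs a ha
  have hmono : Monotone a := monotone_nat_of_le_succ fun j => by
    rw [ha]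
    exact Nat.le_add_right _ _
  have hs' := fun j hj => hs j hj (a j)
  simp only [← ha] at hs'
  choose! A B hA hB hAω hBω hP using hs'
  obtain ⟨mA, pA⟩ := measureReal_forall_block (μ := μU) hmono n (A := A)
    fun j hj => by rw [ha]; exact hA j hj
  obtain ⟨mB, pB⟩ := measureReal_forall_block (μ := μV) hmono n (A := B)
    fun j hj => by rw [ha]; exact hB j hj
  refine ⟨{ω | ∀ j < n, ω ∈ A j}, {ω | ∀ j < n, ω ∈ B j}, coordSigma_le _ _ mA,
    coordSigma_le _ _ mB, fun ω hω j hj => hAω j hj ω (hω j hj),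
    fun ω hω j hj => hBω j hj ω (hω j hj), ?_⟩
  rw [pA, pB, ← Finset.prod_mul_distrib, Finset.mul_sum, ← Finset.sum_neg_distrib, Real.exp_sum]
  exact Finset.prod_le_prod (fun _ _ => (Real.exp_pos _).le) fun j hj =>
    hP j (Finset.mem_range.1 hj)

/-! ### Almost sure properties of the driving randomness -/

lemma ArrivalLaw.ae_infinitePi_nonneg (hU : ArrivalLaw lam μU) :
    ∀ᵐ ω ∂(Measure.infinitePi fun _ : ℕ => μU), ∀ i, 0 ≤ ω i :=
  ae_all_iff.2 fun i =>
    (measurePreserving_eval_infinitePi (fun _ : ℕ => μU) i).quasiMeasurePreserving.ae hU.ae_nonneg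

lemma ArrivalLaw.ae_exists_lt_sum (hU : ArrivalLaw lam μU) :
    ∀ᵐ ω ∂(Measure.infinitePi fun _ : ℕ => μU), ∀ c : ℝ, ∃ n, c < ∑ i ∈ Finset.range n, ω i := by
  have hmp := fun i => measurePreserving_eval_infinitePi (fun _ : ℕ => μU) i
  have hind : iIndepFun (fun (i : ℕ) (ω : ℕ → ℝ) => ω i) (Measure.infinitePi fun _ : ℕ => μU) :=
    iIndepFun_infinitePi (X := fun _ => id) (fun _ => measurable_id)
  have h := strong_law_ae_real (μ := Measure.infinitePi fun _ : ℕ => μU)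
    (fun (i : ℕ) (ω : ℕ → ℝ) => ω i) ((hmp 0).integrable_comp_of_integrable hU.integrable)
    (fun i j hij => hind.indepFun hij)
    (fun i => ⟨(hmp i).aemeasurable, (hmp 0).aemeasurable, by
      rw [(hmp i).map_eq, (hmp 0).map_eq]⟩)
  have hmean : ∫ ω, ω 0 ∂(Measure.infinitePi fun _ : ℕ => μU) = 1 / lam := by
    rw [← hU.mean, ← integral_map (f := fun u : ℝ => u) (hmp 0).aemeasurable (by fun_prop),
      (hmp 0).map_eq]
  filter_upwards [h] with ω hω c
  rw [hmean] at hω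
  have hlim : Tendsto (fun n : ℕ => (n : ℝ) * ((∑ i ∈ Finset.range n, ω i) / n)) atTop atTop :=
    tendsto_natCast_atTop_atTop.atTop_mul_pos (one_div_pos.2 hU.rate_pos) hω
  obtain ⟨n, hn, hn0⟩ := ((hlim.eventually_gt_atTop c).and (eventually_ge_atTop 1)).exists
  have : (n : ℝ) ≠ 0 := by positivity
  refine ⟨n, ?_⟩
  rwa [mul_div_cancel₀ _ this] at hn

/-- Finiteness matters because `Set.ncard` of an infinite set is `0`, so counts are monotone only
for finite sets. It follows from the divergence of the sums of interarrival times, by the strong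
law. -/
lemma ArrivalLaw.ae_pathLaw (hU : ArrivalLaw lam μU) (μV : Measure ℝ) [IsProbabilityMeasure μV]
    {s : ℕ} (hs : 0 < s) (b : ℝ) :
    ∀ᵐ ω ∂(pathLaw μU μV s b), 0 ≤ ω.1 ∧ (∀ i, 0 ≤ ω.2.1 i) ∧
      ∀ t, {i | arrival s ω i ≤ t}.Finite := by
  have h1 : ∀ᵐ x ∂((cond μU (Ioi (s * b))).map fun x => x - s * b), 0 ≤ x := by
    rw [ae_map_iff (by fun_prop) measurableSet_Ici]
    filter_upwards [ae_cond_mem (μ := μU) (measurableSet_Ioi (a := s * b))] with x hx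
    exact sub_nonneg.2 (le_of_lt hx)
  have h2 : ∀ᵐ ω ∂(pathLaw μU μV s b), 0 ≤ ω.1 := Measure.quasiMeasurePreserving_fst.ae h1
  have h3 := Measure.quasiMeasurePreserving_fst (μ := Measure.infinitePi fun _ : ℕ => μU)
    (ν := Measure.infinitePi fun _ : ℕ => μV) |>.ae
    (hU.ae_infinitePi_nonneg.and hU.ae_exists_lt_sum)
  have h4 : ∀ᵐ ω ∂(pathLaw μU μV s b), (∀ i, 0 ≤ ω.2.1 i) ∧
      ∀ c : ℝ, ∃ n, c < ∑ i ∈ Finset.range n, ω.2.1 i :=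
    Measure.quasiMeasurePreserving_snd.ae h3
  filter_upwards [h2, h4] with ω hω1 hω
  refine ⟨hω1, hω.1, fun t => ?_⟩
  obtain ⟨n, hn⟩ := hω.2 (s * t)
  refine (Set.finite_lt_nat n).subset fun i hi => ?_
  by_contra! hni
  have hs' : (0 : ℝ) < s := Nat.cast_pos.2 hs
  have h5 : arrival s ω n ≤ arrival s ω i := monotone_arrival hω.1 (not_lt.1 hni)
  have h6 : t < arrival s ω n := by
    rw [arrival, lt_div_iff₀' hs']
    linarith
  exact absurd (h5.trans hi) (not_le.2 h6)

/-- The first interarrival time is unconstrained, so the probability does not depend on the age `b`.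
-/
lemma pathLaw_prod {s : ℕ} {b : ℝ} (hb : μU (Ioi (s * b)) ≠ 0) (A B : Set (ℕ → ℝ)) :
    pathLaw μU μV s b (univ ×ˢ (A ×ˢ B)) =
      ENNReal.ofReal ((Measure.infinitePi fun _ : ℕ => μU).real A *
        (Measure.infinitePi fun _ : ℕ => μV).real B) := by
  have := cond_isProbabilityMeasure hb
  have : IsProbabilityMeasure ((cond μU (Ioi (s * b))).map fun x => x - s * b) :=
    Measure.isProbabilityMeasure_map (by fun_prop)
  rw [pathLaw, Measure.prod_prod, Measure.prod_prod, measure_univ, one_mul,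
    ENNReal.ofReal_mul measureReal_nonneg, ofReal_measureReal, ofReal_measureReal]

/-! ### Riemann sums of antitone functions -/

lemma sub_mem_Icc_of_antitone {G : ℝ → ℝ} (hG : Antitone G) (hI : ∀ a, IntegrableOn G (Ioi a))
    {a b : ℝ} (hab : a ≤ b) :
    (b - a) * G b ≤ (∫ u in Ioi a, G u) - ∫ u in Ioi b, G u ∧
      (∫ u in Ioi a, G u) - ∫ u in Ioi b, G u ≤ (b - a) * G a := by
  rw [intervalIntegral.integral_Ioi_sub_Ioi' (hI a) (hI b)]
  have hi : IntervalIntegrable G volume a b := hG.intervalIntegrable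
  have h1 := intervalIntegral.integral_mono_on hab (intervalIntegrable_const (c := G b)) hi
    fun x hx => hG hx.2
  have h2 := intervalIntegral.integral_mono_on hab hi (intervalIntegrable_const (c := G a))
    fun x hx => hG hx.1
  constructor
  · simpa using h1
  · simpa using h2

/-- The sampling points `T + h, T, ..., T - (j - 2) h` are the service thresholds of the tilted
blocks. Each term is compared with the integral over the adjacent interval of length `h`, on the
right for the lower bound and on the left for the upper one. -/
lemma riemann_sum_bounds {G : ℝ → ℝ} (hG : Antitone G) (hI : ∀ a, IntegrableOn G (Ioi a))
    {T h : ℝ} (hh : 0 ≤ h) (j : ℕ) :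
    (∫ u in Ioi (T - (j - 2) * h), G u) - (∫ u in Ioi (T + 2 * h), G u) ≤
        ∑ l ∈ Finset.range j, h * G (T - (l - 1) * h) ∧
      ∑ l ∈ Finset.range j, h * G (T - (l - 1) * h) ≤
        (∫ u in Ioi (T - (j - 1) * h), G u) - ∫ u in Ioi (T + h), G u := by
  induction j with
  | zero =>
    constructor
    · simp
    · simp
  | succ j ih =>
    rw [Finset.sum_range_succ]
    have h1 := (sub_mem_Icc_of_antitone hG hI
      (show T - (j - 1) * h ≤ T - ((j : ℝ) - 2) * h by nlinarith)).2
    have h2 := (sub_mem_Icc_of_antitone hG hI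
      (show T - j * h ≤ T - ((j : ℝ) - 1) * h by nlinarith)).1
    have e1 : T - ((j : ℝ) - 2) * h - (T - (j - 1) * h) = h := by ring
    have e2 : T - ((j : ℝ) - 1) * h - (T - j * h) = h := by ring
    rw [e1] at h1
    rw [e2] at h2
    have e3 : T - (((j + 1 : ℕ) : ℝ) - 2) * h = T - ((j : ℝ) - 1) * h := by push_cast; ring
    have e4 : T - (((j + 1 : ℕ) : ℝ) - 1) * h = T - (j : ℝ) * h := by push_cast; ring
    rw [e3, e4]
    constructor
    · linarith [ih.1]
    · linarith [ih.2]

/-! ### The choice of the horizon -/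

lemma continuous_cdf (hV : ServiceLaw μV f) : Continuous (cdf μV) := by
  refine continuous_iff_continuousAt.2 fun y => ?_
  have h0 : μV {y} = 0 := by
    rw [hV.density, withDensity_apply _ (measurableSet_singleton _)]
    simp
  rw [← measure_cdf μV, StieltjesFunction.measure_singleton, ENNReal.ofReal_eq_zero,
    sub_nonpos] at h0
  rw [(cdf μV).mono.continuousAt_iff_leftLim_eq_rightLim, StieltjesFunction.rightLim_eq]
  exact le_antisymm ((cdf μV).mono.leftLim_le le_rfl) h0

lemma exists_Fbar_eq (hV : ServiceLaw μV f) {v : ℝ} (hv : 0 < v) (hv1 : v < 1) :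
    ∃ y, 0 < y ∧ Fbar μV y = v := by
  have hc : Continuous (Fbar μV) := continuous_const.sub (continuous_cdf hV)
  have hlim : Tendsto (Fbar μV) atTop (𝓝 0) := by
    have := (tendsto_const_nhds (x := (1 : ℝ))).sub (tendsto_cdf_atTop μV)
    rwa [sub_self] at this
  obtain ⟨b, hb, hb0⟩ := ((hlim.eventually_lt_const hv).and (eventually_ge_atTop 0)).exists
  obtain ⟨y, hy, rfl⟩ := intermediate_value_Icc' hb0 hc.continuousOn
    ⟨hb.le, by rw [Fbar_zero hV]; exact hv1.le⟩
  refine ⟨y, hy.1.lt_of_ne ?_, rfl⟩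
  rintro rfl
  rw [Fbar_zero hV] at hv1
  exact lt_irrefl _ hv1

/-- Beyond some point the tail is small while its integral is still positive. -/
lemma exists_Fbar_le_tailInt_pos (hV : ServiceLaw μV f) :
    ∃ y, 0 < y ∧ Fbar μV y ≤ 1 / 16 ∧ 0 < tailInt μV y := by
  obtain ⟨y, hy, hFy⟩ := exists_Fbar_eq hV (v := 1 / 16) (by norm_num) (by norm_num)
  obtain ⟨z, hz, hFz⟩ := exists_Fbar_eq hV (v := 1 / 32) (by norm_num) (by norm_num)
  have hyz : y < z := by
    by_contra! hle
    have := antitone_Fbar (μV := μV) hle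
    rw [hFy, hFz] at this
    norm_num at this
  refine ⟨y, hy, hFy.le, ?_⟩
  have h1 := le_tailInt_sub hV hyz.le
  have h2 := tailInt_nonneg (μV := μV) z
  rw [hFz] at h1
  linarith

/-- Markov's inequality at twice the mean. -/
lemma ArrivalLaw.half_le_measureReal_Icc (hU : ArrivalLaw lam μU) {x : ℝ} (hx : 2 / lam ≤ x) :
    1 / 2 ≤ μU.real (Icc 0 x) := by
  have hlam := hU.rate_pos
  have hx0 : 0 < x := (by positivity : 0 < 2 / lam).trans_le hx
  have h1 := mul_meas_ge_le_integral_of_nonneg hU.ae_nonneg hU.integrable x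
  rw [hU.mean] at h1
  have h2 : μU.real {u | x ≤ u} ≤ 1 / 2 := by
    rw [div_le_iff₀ hlam] at hx
    rw [le_div_iff₀ hlam] at h1
    have h3 : 0 ≤ μU.real {u | x ≤ u} := measureReal_nonneg
    nlinarith
  have h3 : (1 : ℝ) ≤ μU.real (Icc 0 x ∪ {u | x ≤ u}) := by
    have : μU (Icc 0 x ∪ {u | x ≤ u}) = 1 := by
      have hm : MeasurableSet (Icc 0 x ∪ {u | x ≤ u}) := measurableSet_Icc.union measurableSet_Ici
      rw [← prob_compl_eq_zero_iff hm]
      refine measure_mono_null ?_ hU.nonneg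
      intro u hu
      simp only [mem_compl_iff, mem_union, not_or] at hu
      by_contra! h
      rcases le_total u x with hux | hux
      · exact hu.1 ⟨not_lt.1 h, hux⟩
      · exact hu.2 hux
    rw [measureReal_def, this, ENNReal.toReal_one]
  have h4 := measureReal_union_le (μ := μU) (Icc 0 x) {u | x ≤ u}
  linarith

end Family

/-! ### The tilted blocks that lead to overflow -/

/-- The sequence with first element `x`, followed by the sequence `g`. -/
def headTail {α : Type*} (x : α) (g : ℕ → α) : ℕ → α
  | 0 => x
  | l + 1 => g l

/-- A ramp block followed by `m` blocks of duration about `h = T / m` such that, `T` time units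
after the ramp, more than `s` customers are present, and such that before that time the number of
customers that will still be present then exceeds the upper limit of the band. -/
structure BlockScheme (μU μV : Measure ℝ) [IsProbabilityMeasure μU] [IsProbabilityMeasure μV]
    (lam Δ rate : ℝ) where
  (m : ℕ) (T h slack ρ : ℝ) (lo hi u c cost : ℕ → ℝ) (K : ℕ → ℕ → ℕ)
  T_pos : 0 < T
  Fbar_pos : 0 < Fbar μV T
  h_pos : 0 < h
  T_eq : T = m * h
  slack_nonneg : 0 ≤ slack
  slack_le : m * slack ≤ h
  ρ_pos : 0 < ρ
  blockBound : ∀ j < m + 1, BlockBound μU μV (lo j) (hi j) (u j) (c j) (cost j) (K j)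
  ramp_service : T + hi 0 ≤ u 0
  block : ∀ j, 1 ≤ j → j ≤ m → lo j = h - slack ∧ hi j = h ∧ T - (j - 2) * h ≤ u j
  above_band : ∀ j ≤ m,
    lam * tailInt μV (T - (j + 1) * h) + ρ ≤ ∑ l ∈ Finset.range (j + 1), c l
  overflow : 1 < ∑ l ∈ Finset.range (m + 1), c l
  cost_le : ∑ l ∈ Finset.range (m + 1), cost l ≤ rate
  below_band : ∀ᶠ s : ℕ in atTop,
    lam * s * tailInt μV Δ + K 0 s + s * ρ ≤ lam * s * tailInt μV 0

section Scheme

variable {lam : ℝ} {μU μV : Measure ℝ} [IsProbabilityMeasure μU] [IsProbabilityMeasure μV]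
  {f : ℝ → ℝ} {θ : ℝ}

/-- The ramp block, with its horizon `T` and arbitrarily small cost. -/
lemma exists_ramp (hU : ArrivalLaw lam μU) (hV : ServiceLaw μV f) {ε : ℝ} (hε : 0 < ε) :
    ∃ e : ℝ, 0 < e ∧ e ≤ ε ∧ ∃ T δ u : ℝ, ∃ K : ℕ → ℕ, 0 < T ∧ tailInt μV T = 2 * e ∧
      T + δ ≤ u ∧ (∃ cost ≤ ε, BlockBound μU μV 0 δ u (4 * lam * e) cost K) ∧
      ∀ᶠ s : ℕ in atTop, (K s : ℝ) ≤ s * (2 * (4 * lam * e)) := by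
  have hlam := hU.rate_pos
  obtain ⟨c, hc, hcF⟩ := exists_mul_sq_tailInt_le hV
  obtain ⟨y, hy, hFy, hty⟩ := exists_Fbar_le_tailInt_pos hV
  -- An upper bound for the ramp's cost once `Fbar(T') ≥ c e²` is inserted. It vanishes at `e = 0`
  -- since `e log e` does.
  have hcont : Continuous fun e : ℝ =>
      8 * lam * (e * Real.log 2 - e * Real.log c - 2 * (e * Real.log e)) := by
    have := Real.continuous_mul_log
    fun_prop
  have h1 : ∀ᶠ e in 𝓝[>] (0 : ℝ),
      8 * lam * (e * Real.log 2 - e * Real.log c - 2 * (e * Real.log e)) < ε :=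
    (hcont.continuousAt.eventually_lt_const (by simpa using hε)).filter_mono nhdsWithin_le_nhds
  have h2 : ∀ᶠ e in 𝓝[>] (0 : ℝ), e < min ε (tailInt μV y / 2) :=
    (eventually_lt_nhds (lt_min hε (by positivity))).filter_mono nhdsWithin_le_nhds
  obtain ⟨e, ⟨hcost, he⟩, he0⟩ := ((h1.and h2).and self_mem_nhdsWithin).exists
  have he0 : 0 < e := he0
  have hey : 2 * e < tailInt μV y := by linarith [he.trans_le (min_le_right _ _)]
  have hy0 := antitone_tailInt hV hy.le
  obtain ⟨T, hT0, hT⟩ := exists_tailInt_eq hV (v := 2 * e) (by positivity) (by linarith)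
  obtain ⟨T', hT'0, hT'⟩ := exists_tailInt_eq hV (v := e) he0 (by linarith)
  have hyT : y < T := by
    by_contra! h
    have := antitone_tailInt hV h
    linarith
  have hTT' : T < T' := by
    by_contra! h
    have := antitone_tailInt hV h
    linarith
  have hFT : Fbar μV T ≤ 1 / 16 := (antitone_Fbar hyT.le).trans hFy
  have hFT' : 0 < Fbar μV T' := Fbar_pos_of_tailInt_pos (hT'.symm ▸ he0)
  -- Since `Fbar ≤ 1/16` beyond `T`, the tail integral needs at least `16 e` to drop from `2 e` to
  -- `e`. With `κ = 4 λ e` each interarrival time is then allowed `δ / (2 κ) ≥ 2 / λ`, which has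
  -- probability at least `1/2`.
  have hδ : 16 * e ≤ T' - T := by
    have h3 := tailInt_sub_le hV hTT'.le
    rw [hT, hT'] at h3
    nlinarith
  obtain ⟨K, hK, hKs⟩ := exists_blockBound_ramp (μU := μU) (μV := μV) (κ := 4 * lam * e)
    (δ := T' - T) (u := T') (by positivity) (by linarith) (hU.half_le_measureReal_Icc (by
      rw [div_le_div_iff₀ hlam (by positivity)]
      nlinarith)) hFT'
  refine ⟨e, he0, (he.trans_le (min_le_left _ _)).le, T, T' - T, T', K, hy.trans hyT, hT,
    by linarith, ⟨_, ?_, hK⟩, hKs⟩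
  have hlog : Real.log c + 2 * Real.log e ≤ Real.log (Fbar μV T') := by
    have h3 := hcF T' hT'0
    rw [hT'] at h3
    calc Real.log c + 2 * Real.log e = Real.log (c * e ^ 2) := by
          rw [Real.log_mul hc.ne' (by positivity), Real.log_pow]
          norm_num
      _ ≤ _ := Real.log_le_log (by positivity) h3
  have h4 := mul_le_mul_of_nonneg_left hlog (show 0 ≤ 8 * lam * e by positivity)
  nlinarith

/-- The order of choice is `t` (drift above `1`), then the ramp size `e` with its horizon `T`, then
the number `m` of blocks, then the slack `ε₁`. Each error is made small against what was fixed
earlier. -/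
lemma exists_blockScheme (hU : ArrivalLaw lam μU) (hV : ServiceLaw μV f)
    (hθ : IsThetaInf μU μV θ) {Δ ε : ℝ} (hΔ : 0 < Δ) (hε : 0 < ε) :
    Nonempty (BlockScheme μU μV lam Δ (θ - psiInf μU μV θ + ε)) := by
  have hlam := hU.rate_pos
  obtain ⟨t, ht, hdrift, hcost⟩ := exists_one_lt_drift_cost_lt hU hV hθ
    (show 0 < ε / 4 by positivity)
  set g := drift μU μV t - 1 with hg
  have hg0 : 0 < g := sub_pos.2 hdrift
  obtain ⟨M, hM0, hM⟩ := hU.exists_abs_tiltRate_le |t|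
  set G : ℝ → ℝ := fun u => tiltRate μU t (Fbar μV u) with hGdef
  set Ψ : ℝ → ℝ := fun u => psiN μU (Real.log (tiltMass t (Fbar μV u))) with hΨdef
  set D := deriv (psiN μU) t * Real.exp t
  have hD0 : 0 ≤ D := mul_nonneg (hlam.le.trans (hU.le_deriv_psiN ht.le)) (Real.exp_pos _).le
  have hGanti : Antitone G := fun a b hab =>
    hU.tiltRate_mono ht.le (Fbar_nonneg b) (antitone_Fbar hab) (Fbar_le_one a)
  have hΨanti : Antitone Ψ := fun a b hab =>
    hU.psiN_strictMono.monotone (log_tiltMass_mono ht.le (Fbar_nonneg b) (antitone_Fbar hab))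
  have hGI : ∀ a, IntegrableOn G (Ioi a) := integrableOn_tiltRate hU hV t
  have hΨI : ∀ a, IntegrableOn Ψ (Ioi a) := integrableOn_psiN_log_tiltMass hU hV ht.le
  have hG0 : ∀ u, 0 ≤ G u := fun u => hU.tiltRate_nonneg ht.le (Fbar_mem_Icc μV u)
  have hΨ0 : ∀ u, 0 ≤ Ψ u := fun u =>
    hU.psiN_nonneg (log_tiltMass_nonneg ht.le (Fbar_nonneg u))
  have hGtail : ∀ a, ∫ u in Ioi a, G u ≤ M * tailInt μV a := fun a => by
    rw [tailInt, ← integral_const_mul]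
    exact integral_mono (hGI a) ((integrableOn_Fbar hV a).const_mul M)
      fun u => (le_abs_self _).trans (hM t le_rfl _ (Fbar_mem_Icc μV u))
  have hΨtail : ∀ a, ∫ u in Ioi a, Ψ u ≤ D * tailInt μV a := fun a => by
    rw [tailInt, ← integral_const_mul]
    exact integral_mono (hΨI a) ((integrableOn_Fbar hV a).const_mul D)
      fun u => hU.psiN_log_tiltMass_le ht.le (Fbar_mem_Icc μV u)
  have hgap : 0 < tailInt μV 0 - tailInt μV Δ := sub_pos.2 (tailInt_lt_tailInt_zero hV hΔ)
  -- The four bounds on `e` serve the ramp's cost, `below_band` (ramp at most `8 λ e s` plus margin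
  -- `λ e s`), and the parts of the drift and of `ψ_∞` beyond the horizon, which are at most `2 M e`
  -- and `2 D e`.
  obtain ⟨e, he0, heε, T, δ, u₀, K₀, hT0, hT, hTu, ⟨cost₀, hcost₀, hblock₀⟩, hK₀⟩ :=
    exists_ramp hU hV (ε := min (min (ε / 8) ((tailInt μV 0 - tailInt μV Δ) / 9))
      (min (g / (8 * (M + 1))) (ε / (16 * (D + 1))))) (by positivity)
  have he2 : 9 * e ≤ tailInt μV 0 - tailInt μV Δ := by
    have := heε.trans ((min_le_left _ _).trans (min_le_right _ _))
    linarith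
  have he3 : 2 * M * e ≤ g / 4 := by
    have := heε.trans ((min_le_right _ _).trans (min_le_left _ _))
    rw [le_div_iff₀ (by positivity)] at this
    nlinarith
  have he4 : 2 * D * e ≤ ε / 8 := by
    have := heε.trans ((min_le_right _ _).trans (min_le_right _ _))
    rw [le_div_iff₀ (by positivity)] at this
    nlinarith
  have hc0 : cost₀ ≤ ε / 8 := hcost₀.trans ((min_le_left _ _).trans (min_le_left _ _))
  have hlim : Tendsto (fun m : ℕ => T / m) atTop (𝓝 0) := tendsto_const_div_atTop_nhds_zero_nat T
  have hsmall : ∀ A B : ℝ, 0 < B → ∀ᶠ m : ℕ in atTop, A * (T / m) ≤ B := fun A B hB => by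
    have := hlim.const_mul A
    rw [mul_zero] at this
    exact this.eventually_le_const hB
  -- Discretisation errors for the band, the overflow and the cost, in this order.
  obtain ⟨m, ⟨⟨hm1, hm2⟩, hm3⟩, hm⟩ := (((hsmall 6 e he0).and
    (hsmall (2 * G 0) (g / 4) (by positivity))).and
    (hsmall (2 * Ψ 0) (ε / 8) (by positivity))).and (eventually_ge_atTop 1) |>.exists
  have hm0 : (0 : ℝ) < m := Nat.cast_pos.2 hm
  set h := T / m with hh
  have hh0 : 0 < h := div_pos hT0 hm0
  have hTm : T = m * h := by rw [hh]; field_simp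
  obtain ⟨ε₁, hε₁, hs1, hs2, hs3, hs4⟩ : ∃ ε₁ : ℝ, 0 < ε₁ ∧ m * ε₁ ≤ h ∧ m * ε₁ ≤ lam * e / 2 ∧
      m * ε₁ ≤ g / 4 ∧ m * ε₁ ≤ ε / 8 := by
    refine ⟨min (min h (lam * e / 2)) (min (g / 4) (ε / 8)) / m, by positivity, ?_⟩
    rw [mul_div_cancel₀ _ hm0.ne']
    exact ⟨(min_le_left _ _).trans (min_le_left _ _), (min_le_left _ _).trans (min_le_right _ _),
      (min_le_right _ _).trans (min_le_left _ _), (min_le_right _ _).trans (min_le_right _ _)⟩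
  choose K hK using fun l : ℕ => exists_blockBound_tilted (μV := μV) hU ht hh0 hε₁
    (T - ((l : ℝ) - 1) * h)
  have hsumC : ∀ j : ℕ, ∑ l ∈ Finset.range (j + 1), headTail (4 * lam * e)
      (fun l : ℕ => h * G (T - ((l : ℝ) - 1) * h) - ε₁) l =
      4 * lam * e + ∑ l ∈ Finset.range j, h * G (T - ((l : ℝ) - 1) * h) - j * ε₁ := by
    intro j
    rw [Finset.sum_range_succ']
    simp only [headTail, Finset.sum_sub_distrib, Finset.sum_const, Finset.card_range, nsmul_eq_mul]
    ring
  have em2 : T - ((m : ℝ) - 2) * h = 2 * h := by rw [hTm]; ring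
  have em1 : T - ((m : ℝ) - 1) * h = h := by rw [hTm]; ring
  refine ⟨{
    m := m, T := T, h := h, slack := ε₁, ρ := lam * e
    lo := headTail 0 fun _ => h - ε₁
    hi := headTail δ fun _ => h
    u := headTail u₀ fun l => T - ((l : ℝ) - 1) * h
    c := headTail (4 * lam * e) fun l => h * G (T - ((l : ℝ) - 1) * h) - ε₁
    cost := headTail cost₀ fun l => t * (h * G (T - ((l : ℝ) - 1) * h)) -
      h * Ψ (T - ((l : ℝ) - 1) * h) + ε₁
    K := headTail K₀ K
    T_pos := hT0
    Fbar_pos := Fbar_pos_of_tailInt_pos (by rw [hT]; positivity)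
    h_pos := hh0
    T_eq := hTm
    slack_nonneg := hε₁.le
    slack_le := hs1
    ρ_pos := mul_pos hlam he0
    blockBound := ?_
    ramp_service := hTu
    block := ?_
    above_band := ?_
    overflow := ?_
    cost_le := ?_
    below_band := ?_ }⟩
  · rintro (_ | l) _
    · exact hblock₀
    · exact hK l
  · rintro (_ | l) h1 _
    · exact absurd h1 (by norm_num)
    · refine ⟨rfl, rfl, le_of_eq ?_⟩
      simp only [headTail]
      push_cast
      ring
  -- The ramp contributes `4 λ e`. The truncated tail takes `2 λ e`, the shift by three steps `3 λ h
  -- ≤ λ e / 2` and the slack `λ e / 2`, which leaves `ρ = λ e`.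
  · intro j hj
    rw [hsumC]
    have h1 := (riemann_sum_bounds antitone_Fbar (integrableOn_Fbar hV) (T := T) hh0.le j).1
    have h2 : lam * ∑ l ∈ Finset.range j, h * Fbar μV (T - ((l : ℝ) - 1) * h) ≤
        ∑ l ∈ Finset.range j, h * G (T - ((l : ℝ) - 1) * h) := by
      rw [Finset.mul_sum]
      refine Finset.sum_le_sum fun l _ => ?_
      have := mul_le_mul_of_nonneg_left
        (hU.mul_le_tiltRate ht.le (Fbar_mem_Icc μV (T - ((l : ℝ) - 1) * h))) hh0.le
      linarith
    have h3 : tailInt μV (T - (j + 1) * h) - tailInt μV (T - ((j : ℝ) - 2) * h) ≤ 3 * h := by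
      refine (tailInt_sub_le hV (by nlinarith)).trans ?_
      have e1 : T - ((j : ℝ) - 2) * h - (T - (j + 1) * h) = 3 * h := by ring
      rw [e1]
      exact mul_le_of_le_one_right (by positivity) (Fbar_le_one _)
    have h4 : tailInt μV (T + 2 * h) ≤ 2 * e := by
      rw [← hT]
      exact antitone_tailInt hV (by linarith)
    have h5 : (j : ℝ) * ε₁ ≤ m * ε₁ := by gcongr
    change tailInt μV (T - ((j : ℝ) - 2) * h) - tailInt μV (T + 2 * h) ≤ _ at h1
    have h6 : lam * (tailInt μV (T - (j + 1) * h) - 3 * h - 2 * e) ≤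
        lam * ∑ l ∈ Finset.range j, h * Fbar μV (T - ((l : ℝ) - 1) * h) :=
      mul_le_mul_of_nonneg_left (by linarith) hlam.le
    have h7 : lam * (6 * h) ≤ lam * e := mul_le_mul_of_nonneg_left hm1 hlam.le
    linarith
  · rw [hsumC]
    have h1 := (riemann_sum_bounds hGanti hGI (T := T) hh0.le m).1
    rw [em2] at h1
    have h2 := (sub_mem_Icc_of_antitone hGanti hGI (show (0 : ℝ) ≤ 2 * h by positivity)).2
    have h3 := (sub_mem_Icc_of_antitone hGanti hGI (show T ≤ T + 2 * h by linarith)).1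
    have h4 : 0 ≤ (T + 2 * h - T) * G (T + 2 * h) := mul_nonneg (by linarith) (hG0 _)
    have h5 := hGtail T
    rw [hT] at h5
    have h6 : ∫ u in Ioi (0 : ℝ), G u = g + 1 := by rw [hg]; simp only [drift]; ring
    have h7 : 0 < 4 * lam * e := by positivity
    rw [h6] at h2
    linarith
  · rw [Finset.sum_range_succ']
    simp only [headTail, Finset.sum_add_distrib, Finset.sum_sub_distrib, Finset.sum_const,
      Finset.card_range, nsmul_eq_mul, ← Finset.mul_sum]
    rw [Finset.mul_sum, Finset.mul_sum]
    have h1 := (riemann_sum_bounds hGanti hGI (T := T) hh0.le m).2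
    have h2 := (riemann_sum_bounds hΨanti hΨI (T := T) hh0.le m).1
    rw [em1] at h1
    rw [em2] at h2
    have h3 := (sub_mem_Icc_of_antitone hGanti hGI hh0.le).1
    have h4 : 0 ≤ (h - 0) * G h := mul_nonneg (by linarith) (hG0 _)
    have h5 : 0 ≤ ∫ u in Ioi (T + h), G u := integral_nonneg hG0
    have h6 := (sub_mem_Icc_of_antitone hΨanti hΨI (show (0 : ℝ) ≤ 2 * h by positivity)).2
    have h7 := (sub_mem_Icc_of_antitone hΨanti hΨI (show T ≤ T + 2 * h by linarith)).1
    have h8 : 0 ≤ (T + 2 * h - T) * Ψ (T + 2 * h) := mul_nonneg (by linarith) (hΨ0 _)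
    have h9 := hΨtail T
    rw [hT] at h9
    have h10 : ∫ u in Ioi (0 : ℝ), Ψ u = psiInf μU μV t := (psiInf_eq μU μV t).symm
    have h11 : ∫ u in Ioi (0 : ℝ), G u = drift μU μV t := rfl
    rw [h10] at h6
    rw [h11] at h3
    have h12 : t * ∑ l ∈ Finset.range m, h * G (T - ((l : ℝ) - 1) * h) ≤ t * drift μU μV t :=
      mul_le_mul_of_nonneg_left (by linarith) ht.le
    simp only [← Finset.mul_sum] at h2 h12 ⊢
    linarith
  · filter_upwards [hK₀] with s hs
    simp only [headTail]
    have h1 := mul_le_mul_of_nonneg_left he2 (show 0 ≤ lam * (s : ℝ) by positivity)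
    linarith

end Scheme

/-! ### The lower bound -/

section LowerBound

variable {lam : ℝ} {μU μV : Measure ℝ} [IsProbabilityMeasure μU] [IsProbabilityMeasure μV]
  {f : ℝ → ℝ}

lemma notMem_band_of_lt {C η γ : ℝ} {s : ℕ} {y M x : ℝ} (hF : 0 < Fbar μV y)
    (hM : |C * xi lam η γ μV y| ≤ M)
    (hx : lam * s * tailInt μV y + √s * M ≤ x ∨ x ≤ lam * s * tailInt μV y - √s * M) :
    x ∉ band lam C η γ μV s y := by
  rw [band, if_neg hF.ne', mem_Ioo, not_and_or, not_lt, not_lt]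
  have h1 := mul_le_mul_of_nonneg_left ((le_abs_self _).trans hM) (Real.sqrt_nonneg s)
  rw [mul_assoc (√(s : ℝ))]
  rcases hx with hx | hx
  · right
    linarith
  · left
    linarith

lemma IsInitialState.le_upper {C η γ : ℝ} {s : ℕ} {r : ℝ → ℕ} {b y M : ℝ} (hlam : 0 < lam)
    (hr : IsInitialState lam C η γ μU μV s r b) (hy : 0 ≤ y)
    (hM : |C * xi lam η γ μV y| ≤ M) : (r y : ℝ) ≤ lam * s * tailInt μV y + √s * M := by
  have h := hr.inBand y hy
  have h1 := mul_le_mul_of_nonneg_left ((le_abs_self _).trans hM) (Real.sqrt_nonneg s)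
  have h2 : 0 ≤ lam * s * tailInt μV y :=
    mul_nonneg (mul_nonneg hlam.le (Nat.cast_nonneg s)) (tailInt_nonneg y)
  have h3 : 0 ≤ √(s : ℝ) * M := mul_nonneg (Real.sqrt_nonneg _) ((abs_nonneg _).trans hM)
  rw [band] at h
  split_ifs at h with h0
  · rw [mem_singleton_iff] at h
    rw [h]
    positivity
  · have h4 := h.2
    rw [mul_assoc (√(s : ℝ))] at h4
    linarith

/-- The probability that overflow precedes the return to the band, for all initial states
simultaneously. -/
lemma eventually_le_pathLaw (hU : ArrivalLaw lam μU) (hV : ServiceLaw μV f)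
    (hload : lam * ∫ y, y ∂μV < 1) {Δ C η γ rate : ℝ} (hΔ : 0 < Δ) (hη : 0 < η)
    (S : BlockScheme μU μV lam Δ rate) :
    ∀ᶠ s : ℕ in atTop, ∀ (r : ℝ → ℕ) (b : ℝ), IsInitialState lam C η γ μU μV s r b →
      ENNReal.ofReal (Real.exp (-(s * rate))) ≤ pathLaw μU μV s b
        {ω | firstLossTime s r ω < returnTime lam C η γ μV Δ s (QLoss s r ω) ∧
          overflowTime s r ω < returnTime lam C η γ μV Δ s (QInf s r ω)} := by
  have hlam := hU.rate_pos
  rw [integral_eq_tailInt_zero hV] at hload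
  obtain ⟨M, hM0, hM⟩ := exists_abs_mul_xi_le hV hlam hη C γ
  have hF0 : 0 < Fbar μV 0 := by rw [Fbar_zero hV]; norm_num
  -- The factor `2` is for `hlow`, where the initial state may lie `√s M` above the centre at `Δ`
  -- and the count must lie `√s M` below the centre at `0`.
  have hsqrt : ∀ ρ : ℝ, 0 < ρ → ∀ᶠ s : ℕ in atTop, 2 * (√(s : ℝ) * M) ≤ s * ρ := by
    intro ρ hρ
    have h1 : Tendsto (fun s : ℕ => √(s : ℝ)) atTop atTop :=
      Real.tendsto_sqrt_atTop.comp tendsto_natCast_atTop_atTop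
    filter_upwards [h1.eventually_ge_atTop (2 * M / ρ)] with s hs
    rw [div_le_iff₀ hρ] at hs
    calc 2 * (√(s : ℝ) * M) = √(s : ℝ) * (2 * M) := by ring
      _ ≤ √(s : ℝ) * (√(s : ℝ) * ρ) := by gcongr
      _ = s * ρ := by rw [← mul_assoc, Real.mul_self_sqrt (Nat.cast_nonneg s)]
  filter_upwards [eventually_exists_sets_of_blockBound S.blockBound, S.below_band,
    hsqrt S.ρ S.ρ_pos, hsqrt (1 - lam * tailInt μV 0) (by linarith), eventually_gt_atTop 0]
    with s hs hbelow hsρ hsload hs0 r b hr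
  have hs0' : (0 : ℝ) < s := Nat.cast_pos.2 hs0
  set a : ℕ → ℕ := fun j => ∑ l ∈ Finset.range j, S.K l s with hadef
  have ha : ∀ j, a (j + 1) = a j + S.K j s := fun j => Finset.sum_range_succ _ _
  have ha1 : a 1 = S.K 0 s := by simp [hadef]
  have hamono : Monotone a := monotone_nat_of_le_succ fun j => by
    rw [ha]
    exact Nat.le_add_right _ _
  obtain ⟨A, B, -, -, hA, hB, hP⟩ := hs a ha
  have hprob : ENNReal.ofReal (Real.exp (-(s * rate))) ≤
      pathLaw μU μV s b (univ ×ˢ (A ×ˢ B)) := by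
    rw [pathLaw_prod hr.age_possible]
    refine ENNReal.ofReal_le_ofReal (le_trans (Real.exp_le_exp.2 ?_) hP)
    have := mul_le_mul_of_nonneg_left S.cost_le hs0'.le
    linarith
  refine hprob.trans (measure_mono_ae ?_)
  filter_upwards [hU.ae_pathLaw μV hs0 b] with ω hω hωAB
  obtain ⟨hω1, hω2, hfin⟩ := hω
  obtain ⟨-, hωA, hωB⟩ := hωAB
  have hmono : Monotone (arrival s ω) := monotone_arrival hω2
  set τ := arrival s ω (a 1) with hτ
  have hτ0 : 0 ≤ τ := div_nonneg (add_nonneg hω1 (Finset.sum_nonneg fun i _ => hω2 i)) hs0'.le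
  have hsurv : ∀ j ≤ S.m, ∀ t, τ + j * S.h ≤ t → s * ∑ l ∈ Finset.range (j + 1), S.c l ≤
      ({i | arrival s ω i ≤ t ∧ τ + S.T < completion s ω i}.ncard : ℝ) := by
    intro j hj t ht
    refine mul_sum_le_ncard_survivors hs0 hmono hfin hamono S.slack_nonneg S.slack_le
      (hA _ hωA 0 (by omega)).2 ?_ ?_ (fun j hj => hB _ hωB j (by omega)) S.ramp_service
      (fun j h1 h2 => (S.block j h1 h2).2.2) hj ht
    · intro j h1 h2
      rw [← (S.block j h1 h2).1]
      exact (hA _ hωA j (by omega)).1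
    · intro j h1 h2
      rw [← (S.block j h1 h2).2.1]
      exact (hA _ hωA j (by omega)).2
  have hlow : ∀ k : ℕ, 1 ≤ k → k * Δ < τ → ∀ N : ℕ,
      N ≤ r (k * Δ) + {i | arrival s ω i ≤ k * Δ}.ncard → (N : ℝ) ∉ band lam C η γ μV s 0 := by
    intro k hk hkτ N hN
    refine notMem_band_of_lt hF0 (hM 0 le_rfl) (Or.inr ?_)
    have hk' : Δ ≤ k * Δ := le_mul_of_one_le_left hΔ.le (by exact_mod_cast hk)
    have h1 : r (k * Δ) ≤ r Δ := hr.antitone hΔ.le (hΔ.le.trans hk') hk'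
    have h2 : {i | arrival s ω i ≤ k * Δ}.ncard ≤ S.K 0 s := by
      rw [← ha1, ← Finset.card_range (a 1), ← Set.ncard_coe_finset]
      refine Set.ncard_le_ncard ?_ (Finset.finite_toSet _)
      intro i hi
      rw [Finset.mem_coe, Finset.mem_range]
      by_contra! h
      exact absurd (hmono h) (not_le.2 (lt_of_le_of_lt hi hkτ))
    have h3 : (N : ℝ) ≤ r Δ + S.K 0 s := by exact_mod_cast hN.trans (add_le_add h1 h2)
    have h4 := hr.le_upper hlam hΔ.le (hM Δ hΔ.le)
    linarith
  have hhigh : ∀ t, τ ≤ t → t ≤ τ + S.T → ∀ N : ℕ,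
      {i | arrival s ω i ≤ t ∧ τ + S.T < completion s ω i}.ncard ≤ N →
      (N : ℝ) ∉ band lam C η γ μV s (τ + S.T - t) := by
    intro t ht1 ht2 N hN
    have hFy : 0 < Fbar μV (τ + S.T - t) := S.Fbar_pos.trans_le (antitone_Fbar (by linarith))
    refine notMem_band_of_lt hFy (hM _ (by linarith)) (Or.inl ?_)
    -- By time `t` the ramp and the first `j` tilted blocks have certainly arrived, and rounding
    -- down costs less than one step `h` in the argument of `tailInt`.
    set j := ⌊(t - τ) / S.h⌋₊
    have hj1 : j * S.h ≤ t - τ :=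
      (le_div_iff₀ S.h_pos).1 (Nat.floor_le (div_nonneg (by linarith) S.h_pos.le))
    have hj2 : t - τ < (j + 1) * S.h := (div_lt_iff₀ S.h_pos).1 (Nat.lt_floor_add_one _)
    have hjm : j ≤ S.m := by
      have h1 : (t - τ) / S.h ≤ S.m := by
        rw [div_le_iff₀ S.h_pos, ← S.T_eq]
        linarith
      exact Nat.floor_le_of_le h1
    have h1 := hsurv j hjm t (by linarith)
    have h2 := S.above_band j hjm
    have h3 : tailInt μV (τ + S.T - t) ≤ tailInt μV (S.T - (j + 1) * S.h) :=
      antitone_tailInt hV (by linarith)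
    have h4 : lam * tailInt μV (τ + S.T - t) + S.ρ ≤ ∑ l ∈ Finset.range (j + 1), S.c l :=
      le_trans (by gcongr) h2
    have h5 := mul_le_mul_of_nonneg_left h4 hs0'.le
    have h6 : (({i | arrival s ω i ≤ t ∧ τ + S.T < completion s ω i}.ncard : ℕ) : ℝ) ≤ N :=
      Nat.cast_le.2 hN
    have h7 : 0 ≤ √(s : ℝ) * M := by positivity
    linarith
  have hover : s < {i | arrival s ω i ≤ τ + S.T ∧ τ + S.T < completion s ω i}.ncard := by
    have h1 := hsurv S.m le_rfl (τ + S.T) (by rw [← S.T_eq])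
    have h2 := mul_lt_mul_of_pos_left S.overflow hs0'
    rw [mul_one] at h2
    exact_mod_cast h2.trans_le h1
  have hfull : ∀ N : ℕ, s ≤ N → (N : ℝ) ∉ band lam C η γ μV s 0 := by
    intro N hN
    refine notMem_band_of_lt hF0 (hM 0 le_rfl) (Or.inl ?_)
    have h1 : (s : ℝ) ≤ N := Nat.cast_le.2 hN
    have h2 : 0 ≤ √(s : ℝ) * M := by positivity
    linarith
  exact ⟨firstLossTime_lt_returnTime hΔ hmono hfin hlow hhigh hover hfull,
    overflowTime_lt_returnTime hΔ (add_pos_of_nonneg_of_pos hτ0 S.T_pos) hfin hlow hhigh hover⟩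

/-- Exponential lower bounds for all rates above `I` give a lower bound for the exponential rate of
decay. -/
lemma neg_le_liminf_log {p : ℕ → ENNReal} {I : ℝ}
    (h : ∀ ε > 0, ∀ᶠ s : ℕ in atTop, ENNReal.ofReal (Real.exp (-(s * (I + ε)))) ≤ p s) :
    ((-I : ℝ) : EReal) ≤
      liminf (fun s : ℕ => ((1 / (s : ℝ) : ℝ) : EReal) * ENNReal.log (p s)) atTop := by
  refine le_of_forall_lt fun c hc => ?_
  obtain ⟨x, hcx, hx⟩ := EReal.lt_iff_exists_real_btwn.1 hc
  refine hcx.trans_le (le_liminf_of_le (by isBoundedDefault) ?_)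
  have hx' : x < -I := EReal.coe_lt_coe_iff.1 hx
  filter_upwards [h (-I - x) (by linarith), eventually_gt_atTop 0] with s hs hs0
  have hs0' : (0 : ℝ) < s := Nat.cast_pos.2 hs0
  have e : (x : EReal) = ((1 / (s : ℝ) : ℝ) : EReal) *
      ENNReal.log (ENNReal.ofReal (Real.exp (-(s * (I + (-I - x)))))) := by
    rw [ENNReal.log_ofReal_of_pos (Real.exp_pos _), Real.log_exp, ← EReal.coe_mul]
    congr 1
    field_simp
    ring
  rw [e]
  exact mul_le_mul_of_nonneg_left (ENNReal.log_monotone hs)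
    (EReal.coe_nonneg.2 (by positivity))

end LowerBound

end

end LossQueue

theorem theorem3 (lam : ℝ) (μU μV : Measure ℝ) [IsProbabilityMeasure μU] [IsProbabilityMeasure μV]
    (f : ℝ → ℝ) (hU : LossQueue.ArrivalLaw lam μU) (hV : LossQueue.ServiceLaw μV f)
    (hload : lam * ∫ y, y ∂μV < 1)
    (Δ C η γ : ℝ) (hΔ : 0 < Δ) (hC : 0 < C) (hη : 0 < η) (hγ : 0 < γ) :
    (∃! θ : ℝ, LossQueue.IsThetaInf μU μV θ) ∧
    ∀ θ : ℝ, LossQueue.IsThetaInf μU μV θ →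
      ∀ (r : ℕ → ℝ → ℕ) (b : ℕ → ℝ),
        (∀ᶠ s : ℕ in atTop, LossQueue.IsInitialState lam C η γ μU μV s (r s) (b s)) →
        ((-(θ - LossQueue.psiInf μU μV θ) : ℝ) : EReal) ≤
            liminf (fun s : ℕ => ((1 / (s : ℝ) : ℝ) : EReal) *
              ENNReal.log (LossQueue.pathLaw μU μV s (b s)
                {ω | LossQueue.firstLossTime s (r s) ω <
                  LossQueue.returnTime lam C η γ μV Δ s (LossQueue.QLoss s (r s) ω)})) atTop ∧
        ((-(θ - LossQueue.psiInf μU μV θ) : ℝ) : EReal) ≤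
            liminf (fun s : ℕ => ((1 / (s : ℝ) : ℝ) : EReal) *
              ENNReal.log (LossQueue.pathLaw μU μV s (b s)
                {ω | LossQueue.overflowTime s (r s) ω <
                  LossQueue.returnTime lam C η γ μV Δ s (LossQueue.QInf s (r s) ω)})) atTop := by
  have hex := LossQueue.existsUnique_isThetaInf hU hV hload
  refine ⟨hex, fun θ hθ r b hr => ?_⟩
  have key : ∀ ε > 0, ∀ᶠ s : ℕ in atTop,
      ENNReal.ofReal (Real.exp (-(s * (θ - LossQueue.psiInf μU μV θ + ε)))) ≤
        LossQueue.pathLaw μU μV s (b s)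
          {ω | LossQueue.firstLossTime s (r s) ω <
              LossQueue.returnTime lam C η γ μV Δ s (LossQueue.QLoss s (r s) ω) ∧
            LossQueue.overflowTime s (r s) ω <
              LossQueue.returnTime lam C η γ μV Δ s (LossQueue.QInf s (r s) ω)} := by
    intro ε hε
    obtain ⟨S⟩ := LossQueue.exists_blockScheme hU hV hθ hΔ hε
    filter_upwards [LossQueue.eventually_le_pathLaw (C := C) (γ := γ) hU hV hload hΔ hη S, hr]
      with s hs hrs
    exact hs (r s) (b s) hrs
  constructor
  · refine LossQueue.neg_le_liminf_log fun ε hε => ?_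
    filter_upwards [key ε hε] with s hs
    exact hs.trans (measure_mono fun ω hω => hω.1)
  · refine LossQueue.neg_le_liminf_log fun ε hε => ?_
    filter_upwards [key ε hε] with s hs
    exact hs.trans (measure_mono fun ω hω => hω.2)
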